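/- Let $M$ be a smooth manifold modelled on a real Banach space $\mathbb{E}$, and let $\nabla$ be a linear connection on $M$, i.e. for every smooth chart $(U_\alpha,\psi_\alpha)$ a smooth map $\Gamma_\alpha:\psi_\alpha(U_\alpha)\to L(\mathbb{E},L(\mathbb{E},\mathbb{E}))$ such that, with $\varphi=\psi_\beta\circ\psi_\alpha^{-1}$, $$d\varphi(x)[\Gamma_\alpha(x,\xi)y]=d^2\varphi(x)(\xi,y)+\Gamma_\beta(\varphi(x),d\varphi(x)\xi)\,d\varphi(x)y .$$ For $k\in\mathbb{N}\cup\{\infty\}$ let $T^kM$ be the set of classes $[\gamma,x]_k$ of smooth curves $\gamma:(-\epsilon,\epsilon)\to M$ with $\gamma(0)=x\in M$, where two curves through $x$ are identified if their derivatives of all orders $1\le j\le k$ (all $j\geq 1$, if $k=\infty$) at $0$ agree in charts; let $\pi_k:T^kM\to M$, $[\gamma,x]_k\mapsto x$. For $k<\infty$, $T^kM$ is the manifold with the charts $\Psi_\alpha^k([\gamma,x]_k)=(\gamma_\alpha(0),\gamma_\alpha'(0),\dots,\frac1{k!}\gamma_\alpha^{(k)}(0))$ on $\pi_k^{-1}(U_\alpha)$,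 where $\gamma_\alpha=\psi_\alpha\circ\gamma$. Put $M_\alpha^0=\mathrm{id}_{\mathbb{E}}$ and $$M_\alpha^{l+1}(x,\xi_1,\dots,\xi_{l+1})y=\tfrac1{l+1}\Big(\sum_{i=1}^{l+1}\partial_iM_\alpha^{l}(x,\xi_1,\dots,\xi_{l})(y,i\xi_i)+\Gamma_\alpha(x,\xi_1)[M_\alpha^{l}(x,\xi_1,\dots,\xi_{l})y]\Big)$$ (so $M^1_\alpha=\Gamma_\alpha$), where $\partial_i$ is the derivative with respect to the $i$-th of the variables $(x,\xi_1,\dots,\xi_l)$, taken in the direction $i\xi_i$. Define $\Phi_\alpha^k:\pi_k^{-1}(U_\alpha)\to\psi_\alpha(U_\alpha)\times\mathbb{E}^k$ by $\Phi_\alpha^k([\gamma,x]_k)=(\gamma_\alpha(0),z_\alpha^1,\dots,z_\alpha^k)$, $$z_\alpha^i=\frac1i\sum_{l=0}^{i-1}\frac1{(i-1-l)!}\,M_\alpha^l\big(\gamma_\alpha(0),\gamma_\alpha'(0),\dots,\tfrac1{l!}\gamma_\alpha^{(l)}(0)\big)\,\gamma_\alpha^{(i-l)}(0).$$ For $i\le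 j$ let $\rho^{ji}$ be the projection of a power of $\mathbb{E}$ onto its first factors, $\mathbb{E}^{j+1}\to\mathbb{E}^{i+1}$ or $\mathbb{E}^{j}\to\mathbb{E}^{i}$. Let $\mathcal{H}_i(\mathbb{E}^i)$ be the Banach space of all $(l_1,\dots,l_i)\in\prod_{j\le i}L(\mathbb{E}^j,\mathbb{E}^j)$ with $\rho^{jk}\circ l_j=l_k\circ\rho^{jk}$ for $k\le j\le i$, and $\mathcal{H}_i^0(\mathbb{E}^i)$ the group of those with all $l_j$ invertible. All projective limits are over $i\in\mathbb{N}$, with the obvious truncation maps. Smoothness between Fréchet spaces is meant in the sense of continuous iterated directional derivatives (Michal, Bastiani, Hamilton). Then: 1. The maps $\Phi_\alpha^k$ are smooth charts of $T^kM$, and for $k<\infty$ the $T^kM$, with the maps $[\gamma,x]_j\mapsto[\gamma,x]_i$ and the trivializations $\tau_\alpha^k=(\psi_\alpha^{-1}\times\mathrm{id})\circ\Phi_\alpha^k$ over $U_\alpha$, form a strong projective system of smooth Banach vector bundles over $M$: the connecting maps are smooth and $(\mathrm{id}\times\rho^{ji})\circ\tau_\alpha^j=\tau_\alpha^i\circ([\gamma,x]_j\mapsto[\gamma,x]_i)$.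 2. $T^\infty M$ is the projective limit of the $T^kM$: the map $[\gamma,x]_\infty\mapsto([\gamma,x]_k)_k$ is a bijection onto $\varprojlim T^kM$, and a homeomorphism if $T^\infty M$ carries the projective limit topology. 3. $\varprojlim\mathbb{E}^{i+1}$ is a Fréchet space, and the maps $\Phi_\alpha^\infty=\varprojlim\Phi_\alpha^i$, from $\pi_\infty^{-1}(U_\alpha)$ onto the open set $\varprojlim(\psi_\alpha(U_\alpha)\times\mathbb{E}^i)$, form an atlas with smooth transition maps: $T^\infty M$ is a smooth Fréchet manifold modelled on $\varprojlim\mathbb{E}^{i+1}$. It is Hausdorff if $M$ is. 4. $\pi_\infty:T^\infty M\to M$ is a generalized Fréchet vector bundle with fibre type the Fréchet space $\varprojlim\mathbb{E}^i$ and structure group $\varprojlim\mathcal{H}_i^0(\mathbb{E}^i)$: the limits $\tau^\infty_\alpha=\varprojlim\tau_\alpha^i:\pi_\infty^{-1}(U_\alpha)\to U_\alpha\times\varprojlim\mathbb{E}^i$ are diffeomorphisms over $U_\alpha$, linear on the fibres for suitable vector space structures of the fibres, and on overlaps $\tau^\infty_\beta\circ(\tau^\infty_\alpha)^{-1}(x,\xi)=(x,T_{\beta\alpha}(x)\cdot\xi)$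 with maps $T_{\beta\alpha}:U_\alpha\cap U_\beta\to\varprojlim\mathcal{H}_i^0(\mathbb{E}^i)$ that satisfy the cocycle condition and are smooth as maps into the Fréchet space $\varprojlim\mathcal{H}_i(\mathbb{E}^i)$. -/

import Mathlib

open scoped Manifold ContDiff Topology
open Set Filter

universe u v w

noncomputable section

/-! ## Fréchet spaces and smooth maps between open subsets of them -/

/-- A real Fréchet space: a locally convex, metrizable, complete topological vector space. -/
structure IsFrechetSpace (F : Type u) [AddCommGroup F] [Module ℝ F] [UniformSpace F] : Prop where
  isUniformAddGroup : IsUniformAddGroup F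
  continuousSMul : ContinuousSMul ℝ F
  locallyConvex : LocallyConvexSpace ℝ F
  metrizable : TopologicalSpace.MetrizableSpace F
  complete : CompleteSpace F

/-- `f` is of class `C^n` on the (open) set `U`, in the sense of calculus in Fréchet spaces
(Michal, Bastiani, Hamilton): `C^0` means continuous, and `C^(n+1)` means that `f` is continuous,
that all directional derivatives `D f (x, v) = lim_{t → 0} (f (x + t v) - f x) / t` exist for
`x ∈ U`, and that `D f` is of class `C^n` on `U × F`. -/
def FrechetCkOn {G : Type v} [AddCommGroup G] [Module ℝ G] [TopologicalSpace G] :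
    (n : ℕ) → {F : Type u} → [AddCommGroup F] → [Module ℝ F] → [TopologicalSpace F] →
      (F → G) → Set F → Prop
  | 0, _, _, _, _, f, U => ContinuousOn f U
  | n + 1, F, _, _, _, f, U =>
      ContinuousOn f U ∧ ∃ f' : F × F → G,
        (∀ x ∈ U, ∀ v : F,
          Tendsto (fun t : ℝ => t⁻¹ • (f (x + t • v) - f x)) (𝓝[≠] 0) (𝓝 (f' (x, v)))) ∧
        FrechetCkOn n f' (U ×ˢ univ)

/-- Smoothness on an open subset of a Fréchet space. -/
def FrechetSmoothOn {F : Type u} [AddCommGroup F] [Module ℝ F] [TopologicalSpace F]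
    {G : Type v} [AddCommGroup G] [Module ℝ G] [TopologicalSpace G] (f : F → G) (U : Set F) :
    Prop :=
  ∀ n : ℕ, FrechetCkOn n f U

/-- A smooth manifold structure on the topological space `X`, modelled on the topological vector
space `F`, given by an atlas indexed by `ι`. -/
structure FrechetAtlas (ι : Type w) (F : Type u) [AddCommGroup F] [Module ℝ F] [TopologicalSpace F]
    (X : Type v) [TopologicalSpace X] where
  chart : ι → OpenPartialHomeomorph X F
  cover : ∀ p : X, ∃ i, p ∈ (chart i).source
  compatible : ∀ i j, FrechetSmoothOn (chart j ∘ (chart i).symm) ((chart i).symm ≫ₕ chart j).source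

/-! ## Projective limits of the powers of a Banach space -/

section Limits

/-- The projection `E^n → E^m` onto the first `m` factors. -/
def truncate (E : Type u) [NormedAddCommGroup E] [NormedSpace ℝ E] {m n : ℕ} (h : m ≤ n) :
    (Fin n → E) →L[ℝ] (Fin m → E) :=
  ContinuousLinearMap.pi fun a => ContinuousLinearMap.proj (Fin.castLE h a)

/-- The projective limit of the system `(E^(i+d))_{i ∈ ℕ}` with the projections onto the first
factors as connecting morphisms, with the projective limit topology. For `d = 1` this is the limit
of the model spaces `E^(i+1)` of the `T^i M`, for `d = 0` the limit of the fibre types `E^i`. -/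
def PowerLim (E : Type u) [NormedAddCommGroup E] [NormedSpace ℝ E] (d : ℕ) :
    Submodule ℝ (∀ i : ℕ, Fin (i + d) → E) where
  carrier := {ξ | ∀ (i j : ℕ) (h : i ≤ j), truncate E (Nat.add_le_add_right h d) (ξ j) = ξ i}
  add_mem' := by
    intro ξ η hξ hη i j h
    simp only [Pi.add_apply, map_add, hξ i j h, hη i j h]
  zero_mem' := by
    intro i j h
    simp
  smul_mem' := by
    intro c ξ hξ i j h
    simp only [Pi.smul_apply, map_smul, hξ i j h]

/-- The Banach space `H_i` of all `(l_0, …, l_i)`, `l_j` a continuous endomorphism of `E^j`, that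
commute with the projections. -/
def EndTower (E : Type u) [NormedAddCommGroup E] [NormedSpace ℝ E] (i : ℕ) :
    Submodule ℝ (∀ j : Fin (i + 1), (Fin (j : ℕ) → E) →L[ℝ] (Fin (j : ℕ) → E)) where
  carrier := {l | ∀ (a b : Fin (i + 1)) (h : a ≤ b) (ξ : Fin (b : ℕ) → E),
    truncate E h (l b ξ) = l a (truncate E h ξ)}
  add_mem' := by
    intro l m hl hm a b h ξ
    simp only [Pi.add_apply, add_apply, map_add, hl a b h, hm a b h]
  zero_mem' := by
    intro a b h ξ
    simp
  smul_mem' := by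
    intro c l hl a b h ξ
    simp only [Pi.smul_apply, smul_apply, map_smul, hl a b h]

/-- The group `H_i^0` of all `(l_0, …, l_i)`, `l_j` a continuous linear automorphism of `E^j`, that
commute with the projections. -/
def AutTower (E : Type u) [NormedAddCommGroup E] [NormedSpace ℝ E] (i : ℕ) :
    Subgroup (∀ j : Fin (i + 1), (Fin (j : ℕ) → E) ≃L[ℝ] (Fin (j : ℕ) → E)) where
  carrier := {l | ∀ (a b : Fin (i + 1)) (h : a ≤ b) (ξ : Fin (b : ℕ) → E),
    truncate E h (l b ξ) = l a (truncate E h ξ)}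
  mul_mem' := by
    intro l m hl hm a b h ξ
    change truncate E h (l b (m b ξ)) = l a (m a (truncate E h ξ))
    rw [hl a b h, hm a b h]
  one_mem' := by
    intro a b h ξ
    rfl
  inv_mem' := by
    intro l hl a b h ξ
    apply (l a).injective
    rw [← hl a b h]
    change truncate E h (l b ((l b).symm ξ)) = l a ((l a).symm (truncate E h ξ))
    simp

/-- The Fréchet space `lim H_i`: the sequences `(t_i)_i`, `t_i ∈ H_i`, that are compatible with the
connecting morphisms `H_j → H_i`, `(l_0, …, l_j) ↦ (l_0, …, l_i)`, for `i ≤ j`. -/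
def EndLim (E : Type u) [NormedAddCommGroup E] [NormedSpace ℝ E] :
    Submodule ℝ (∀ i : ℕ, ∀ j : Fin (i + 1), (Fin (j : ℕ) → E) →L[ℝ] (Fin (j : ℕ) → E)) where
  carrier := {t | (∀ i, t i ∈ EndTower E i) ∧
    ∀ (i j : ℕ) (h : i ≤ j) (a : Fin (i + 1)),
      t j (Fin.castLE (Nat.succ_le_succ h) a) = t i a}
  add_mem' := by
    intro s t hs ht
    exact ⟨fun i => (EndTower E i).add_mem (hs.1 i) (ht.1 i),
      fun i j h a => congrArg₂ (· + ·) (hs.2 i j h a) (ht.2 i j h a)⟩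
  zero_mem' := ⟨fun i => (EndTower E i).zero_mem, fun _ _ _ _ => rfl⟩
  smul_mem' := by
    intro c t ht
    exact ⟨fun i => (EndTower E i).smul_mem c (ht.1 i),
      fun i j h a => congrArg (c • ·) (ht.2 i j h a)⟩

/-- The group `lim H_i^0`, with connecting morphisms `(l_0, …, l_j) ↦ (l_0, …, l_i)`, `i ≤ j`. -/
def AutLim (E : Type u) [NormedAddCommGroup E] [NormedSpace ℝ E] :
    Subgroup (∀ i : ℕ, AutTower E i) where
  carrier := {t | ∀ (i j : ℕ) (h : i ≤ j) (a : Fin (i + 1)),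
    (t j).1 (Fin.castLE (Nat.succ_le_succ h) a) = (t i).1 a}
  mul_mem' := by
    intro s t hs ht i j h a
    exact congrArg₂ (· * ·) (hs i j h a) (ht i j h a)
  one_mem' := by
    intro i j h a
    rfl
  inv_mem' := by
    intro t ht i j h a
    exact congrArg (·⁻¹) (ht i j h a)

/-- The inclusion of `lim H_i^0` into the Fréchet space `lim H_i`. -/
def autLimToEndLim {E : Type u} [NormedAddCommGroup E] [NormedSpace ℝ E]
    (t : AutLim E) : EndLim E :=
  ⟨fun i j => ((t.1 i).1 j : (Fin (j : ℕ) → E) →L[ℝ] (Fin (j : ℕ) → E)), fun i => (t.1 i).2,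
    fun i j h a => congrArg
      (fun l : (Fin (a : ℕ) → E) ≃L[ℝ] (Fin (a : ℕ) → E) =>
        (l : (Fin (a : ℕ) → E) →L[ℝ] (Fin (a : ℕ) → E))) (t.2 i j h a)⟩

/-- The action of `lim H_i^0` on `lim E^i`: the family `(l_i)_i` acts as the limit of the `l_i`. -/
def autLimAct {E : Type u} [NormedAddCommGroup E] [NormedSpace ℝ E] (t : AutLim E) :
    PowerLim E 0 →ₗ[ℝ] PowerLim E 0 where
  toFun ξ := ⟨fun i => (t.1 i).1 (Fin.last i) (ξ.1 i), by
    intro i j h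
    have h1 := (t.1 j).2 (Fin.castLE (Nat.succ_le_succ h) (Fin.last i)) (Fin.last j)
      (Fin.le_last _) (ξ.1 j)
    have h2 := t.2 i j h (Fin.last i)
    have h3 := ξ.2 i j h
    refine h1.trans ?_
    change (t.1 j).1 (Fin.castLE (Nat.succ_le_succ h) (Fin.last i))
      (truncate E (Nat.add_le_add_right h 0) (ξ.1 j)) = _
    rw [h3, h2]⟩
  map_add' ξ η := by
    apply Subtype.ext
    funext i
    exact map_add ((t.1 i).1 (Fin.last i)) (ξ.1 i) (η.1 i)
  map_smul' c ξ := by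
    apply Subtype.ext
    funext i
    exact map_smul ((t.1 i).1 (Fin.last i)) c (ξ.1 i)

end Limits

/-! ## Higher order tangent bundles -/

section Tangent

variable (E : Type u) [NormedAddCommGroup E] [NormedSpace ℝ E]
  (M : Type v) [TopologicalSpace M] [ChartedSpace E M]

/-- The smooth charts of `M`. -/
abbrev SmoothChart : Type (max u v) :=
  {e : OpenPartialHomeomorph M E // e ∈ IsManifold.maximalAtlas 𝓘(ℝ, E) ∞ M}

variable {M}

/-- Smooth curves in `M`, defined near `0`, starting at `x`. (The values outside of
`(-ε, ε)` play no role below.) -/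
structure CurveAt (x : M) where
  toFun : ℝ → M
  map_zero : toFun 0 = x
  smooth : ∃ ε > 0, ContMDiffOn 𝓘(ℝ, ℝ) 𝓘(ℝ, E) ∞ toFun (Ioo (-ε) ε)

variable {E}

/-- `k`-equivalence of curves at `x`: the derivatives of orders `1, …, k` at `0` agree, read in the
charts around `x`. -/
def CurveAt.Equiv {x : M} (k : ℕ) (γ₁ γ₂ : CurveAt E x) : Prop :=
  ∀ e : SmoothChart E M, x ∈ e.1.source → ∀ j : ℕ, 1 ≤ j → j ≤ k →
    iteratedDeriv j (e.1 ∘ γ₁.toFun) 0 = iteratedDeriv j (e.1 ∘ γ₂.toFun) 0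

/-- Infinite equivalence of curves at `x`. -/
def CurveAt.EquivInf {x : M} (γ₁ γ₂ : CurveAt E x) : Prop :=
  ∀ k : ℕ, CurveAt.Equiv k γ₁ γ₂

variable (E)

def curveSetoid (k : ℕ) (x : M) : Setoid (CurveAt E x) where
  r := CurveAt.Equiv k
  iseqv :=
    ⟨fun _ _ _ _ _ _ => rfl, fun h e hx j h1 h2 => (h e hx j h1 h2).symm,
      fun h h' e hx j h1 h2 => (h e hx j h1 h2).trans (h' e hx j h1 h2)⟩

def curveSetoidInf (x : M) : Setoid (CurveAt E x) where
  r := CurveAt.EquivInf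
  iseqv :=
    ⟨fun _ k => (curveSetoid E k x).refl _, fun h k => (curveSetoid E k x).symm (h k),
      fun h h' k => (curveSetoid E k x).trans (h k) (h' k)⟩

variable (M)

/-- The tangent bundle `T^k M` of order `k`: the union over `x` of the sets of classes
`[γ, x]_k`. -/
structure HigherTangent (k : ℕ) where
  base : M
  jet : Quotient (curveSetoid E k base)

/-- The infinite order tangent bundle `T^∞ M`; `base` is the projection `π_∞`. -/
structure InfTangent where
  base : M
  jet : Quotient (curveSetoidInf E base)

variable {E M}

/-- The connecting morphism `T^j M → T^i M`, `[γ, x]_j ↦ [γ, x]_i`, for `i ≤ j`. -/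
def HigherTangent.restrict {i j : ℕ} (h : i ≤ j) (p : HigherTangent E M j) :
    HigherTangent E M i :=
  ⟨p.base, Quotient.map' (s₁ := curveSetoid E j p.base) (s₂ := curveSetoid E i p.base) id
    (fun _ _ hr e hx l h1 h2 => hr e hx l h1 (h2.trans h)) p.jet⟩

/-- The map `T^∞ M → T^k M`, `[γ, x]_∞ ↦ [γ, x]_k`. -/
def InfTangent.toOrder (k : ℕ) (p : InfTangent E M) : HigherTangent E M k :=
  ⟨p.base, Quotient.map' (s₁ := curveSetoidInf E p.base) (s₂ := curveSetoid E k p.base) id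
    (fun _ _ hr => hr k) p.jet⟩

open Classical in
/-- The map `Ψ_e^k : [γ, x]_k ↦ ((e ∘ γ)(0), (e ∘ γ)'(0), …, (1 / k!) (e ∘ γ)^(k)(0))` for `x` in
the domain of the chart `e`; by convention it is `0` elsewhere. -/
def jetChart (e : SmoothChart E M) (k : ℕ) (p : HigherTangent E M k) : Fin (k + 1) → E :=
  if hx : p.base ∈ e.1.source then
    Quotient.lift (s := curveSetoid E k p.base)
      (fun γ => fun j : Fin (k + 1) =>
        ((Nat.factorial (j : ℕ) : ℝ))⁻¹ • iteratedDeriv (j : ℕ) (e.1 ∘ γ.toFun) 0)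
      (by
        intro γ₁ γ₂ h
        funext j
        rcases Nat.eq_zero_or_pos (j : ℕ) with h0 | h0
        · simp [h0, γ₁.map_zero, γ₂.map_zero]
        · rw [h e hx j h0 (Nat.lt_succ_iff.mp j.2)])
      p.jet
  else 0

/-- The topology of `T^k M`: its basic open sets are the `(Ψ_e^k)⁻¹(V)`, `V` open in `E^(k+1)`,
`e` a smooth chart of `M`. -/
instance HigherTangent.topology (k : ℕ) : TopologicalSpace (HigherTangent E M k) :=
  TopologicalSpace.generateFrom
    {s | ∃ (e : SmoothChart E M) (V : Set (Fin (k + 1) → E)), IsOpen V ∧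
      s = {p | p.base ∈ e.1.source ∧ jetChart e k p ∈ V}}

/-- The topology of `T^∞ M`: the projective limit topology, that is, the coarsest one for which the
maps to all `T^k M` are continuous. -/
instance InfTangent.topology : TopologicalSpace (InfTangent E M) :=
  ⨅ k : ℕ, TopologicalSpace.induced (InfTangent.toOrder k) inferInstance

variable (E M)

/-- The projective limit of the `T^k M`: the space of threads. -/
abbrev TangentLim : Type v :=
  {p : ∀ k : ℕ, HigherTangent E M k // ∀ (i j : ℕ) (h : i ≤ j), (p j).restrict h = p i}

/-! ## Linear connections and the induced trivializations -/

/-- A linear connection on `M`, given by its local components (Christoffel maps)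
`Γ_e : e(U) → L(E, L(E, E))`, written `Γ_e(x, ξ) y`. The compatibility condition is the
transformation rule under the change of charts `φ = e' ∘ e⁻¹`; no symmetry is required. -/
structure LinearConnection where
  Γ : SmoothChart E M → E → E →L[ℝ] E →L[ℝ] E
  smooth : ∀ e : SmoothChart E M, ContDiffOn ℝ ∞ (Γ e) e.1.target
  compatible : ∀ (e e' : SmoothChart E M) (x : M), x ∈ e.1.source → x ∈ e'.1.source →
    ∀ ξ y : E,
      fderiv ℝ (e'.1 ∘ e.1.symm) (e.1 x) (Γ e (e.1 x) ξ y) =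
        fderiv ℝ (fderiv ℝ (e'.1 ∘ e.1.symm)) (e.1 x) ξ y +
          Γ e' (e'.1 x) (fderiv ℝ (e'.1 ∘ e.1.symm) (e.1 x) ξ)
            (fderiv ℝ (e'.1 ∘ e.1.symm) (e.1 x) y)

variable {E M}

/-- The local components of the connection map induced by the Christoffel map `Γ` of a chart:
`connComp Γ l (x, ξ_1, …, ξ_l)` is the operator `M^l(x, ξ_1, …, ξ_l)` on `E`, with `M^0 = id`,
`M^1(x, ξ_1) = Γ(x, ξ_1)` and
`M^(l+1) y = (1 / (l+1)) (∑_{i=1}^{l+1} ∂_i M^l (y, i ξ_i) + M^1 [M^l y])`.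
The sum of partial derivatives is written as the total derivative in the direction
`(ξ_1, 2 ξ_2, …, (l+1) ξ_{l+1})`. -/
def connComp (Γ : E → E →L[ℝ] E →L[ℝ] E) : (l : ℕ) → (Fin (l + 1) → E) → E →L[ℝ] E
  | 0, _ => ContinuousLinearMap.id ℝ E
  | l + 1, u =>
      ((l : ℝ) + 1)⁻¹ •
        (fderiv ℝ (connComp Γ l) (fun i => u i.castSucc)
            (fun i : Fin (l + 1) => (((i : ℕ) : ℝ) + 1) • u i.succ) +
          (Γ (u 0) (u 1)).comp (connComp Γ l (fun i => u i.castSucc)))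

/-- The map `(u_0, u_1, …, u_k) ↦ (u_0, z^1, …, z^k)`, where `u_j = γ^(j)(0) / j!` and
`z^i = (1/i) ∑_{l < i} (1 / (i-1-l)!) M^l[u_0, …, u_l] γ^(i-l)(0)`. Note that
`γ^(i-l)(0) / (i-1-l)! = (i-l) u_{i-l}`, and that `z^1 = γ'(0)`. -/
def zMap (Γ : E → E →L[ℝ] E →L[ℝ] E) (k : ℕ) (u : Fin (k + 1) → E) : Fin (k + 1) → E :=
  fun i =>
    if (i : ℕ) = 0 then u 0
    else
      ((i : ℕ) : ℝ)⁻¹ • ∑ l : Fin (i : ℕ),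
        connComp Γ (l : ℕ) (fun j => u ⟨j, by omega⟩)
          ((((i : ℕ) - (l : ℕ) : ℕ) : ℝ) • u ⟨(i : ℕ) - (l : ℕ), by omega⟩)

/-- The map `Φ_e^k : [γ, x]_k ↦ (e(x), (e ∘ γ)'(0), z_e^2, …, z_e^k)` induced by a linear
connection; it is meaningful for `x` in the domain of `e`. -/
def LinearConnection.chart (C : LinearConnection E M) (e : SmoothChart E M) (k : ℕ)
    (p : HigherTangent E M k) : Fin (k + 1) → E :=
  zMap (C.Γ e) k (jetChart e k p)

/-! ## Banach vector bundles and generalized Fréchet vector bundles over `M` -/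

variable (E)

/-- A smooth Banach vector bundle structure, with fibre type `V`, on the projection `π : X → M` of a
Banach manifold `X` (modelled on `B`), given by a family of local trivializations indexed by `ι`
whose transition functions are smooth maps to `GL(V)`. -/
structure BanachBundle (ι : Type*) (V : Type*) [NormedAddCommGroup V] [NormedSpace ℝ V]
    (B : Type*) [NormedAddCommGroup B] [NormedSpace ℝ B]
    {X : Type*} [TopologicalSpace X] [ChartedSpace B X] (π : X → M) where
  triv : ι → Bundle.Trivialization V π
  cover : ∀ x : M, ∃ i, x ∈ (triv i).baseSet
  /-- the trivializations are diffeomorphisms `π⁻¹(U) → U × V` -/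
  smooth_triv : ∀ i, ContMDiffOn 𝓘(ℝ, B) (𝓘(ℝ, E).prod 𝓘(ℝ, V)) ∞ (triv i) (triv i).source
  smooth_triv_symm : ∀ i, ContMDiffOn (𝓘(ℝ, E).prod 𝓘(ℝ, V)) 𝓘(ℝ, B) ∞
    (triv i).toOpenPartialHomeomorph.symm (triv i).target
  /-- the vector space structures of the fibres -/
  [fibreAdd : ∀ x : M, AddCommGroup {p : X // π p = x}]
  [fibreModule : ∀ x : M, Module ℝ {p : X // π p = x}]
  linear : ∀ i, ∀ x ∈ (triv i).baseSet,
    IsLinearMap ℝ (fun p : {p : X // π p = x} => (triv i p.1).2)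
  transition : ι → ι → M → V ≃L[ℝ] V
  transition_smooth : ∀ i j, ContMDiffOn 𝓘(ℝ, E) 𝓘(ℝ, V →L[ℝ] V) ∞
    (fun x => (transition i j x : V →L[ℝ] V)) ((triv i).baseSet ∩ (triv j).baseSet)
  transition_spec : ∀ i j, ∀ p : X, π p ∈ (triv i).baseSet → π p ∈ (triv j).baseSet →
    (triv j p).2 = transition i j (π p) (triv i p).2

/-- A generalized Fréchet vector bundle structure with fibre type `lim E^i` and structure group
`lim H_i^0` on the projection `π : X → M` of a Fréchet manifold `X` (with atlas `𝒜`), given by a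
family of local trivializations indexed by `ι`. The transition functions take their values in
`lim H_i^0` and are smooth as maps to the Fréchet space `lim H_i`. -/
structure GeneralizedFrechetBundle (ι : Type*) {κ : Type*} {F : Type u} [AddCommGroup F]
    [Module ℝ F] [TopologicalSpace F] {X : Type*} [TopologicalSpace X] (𝒜 : FrechetAtlas κ F X)
    (π : X → M) where
  triv : ι → Bundle.Trivialization (PowerLim E 0) π
  cover : ∀ x : M, ∃ i, x ∈ (triv i).baseSet
  /-- the trivializations are diffeomorphisms `π⁻¹(U) → U × lim E^i`, read in the charts of `X`
  and `M` -/
  smooth_triv : ∀ (i : ι) (a : κ) (e : SmoothChart E M),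
    FrechetSmoothOn
      (fun ξ => (e.1 (π ((𝒜.chart a).symm ξ)), (triv i ((𝒜.chart a).symm ξ)).2))
      {ξ | ξ ∈ (𝒜.chart a).target ∧ π ((𝒜.chart a).symm ξ) ∈ (triv i).baseSet ∧
        π ((𝒜.chart a).symm ξ) ∈ e.1.source}
  smooth_triv_symm : ∀ (i : ι) (a : κ) (e : SmoothChart E M),
    FrechetSmoothOn
      (fun q : E × PowerLim E 0 =>
        𝒜.chart a ((triv i).toOpenPartialHomeomorph.symm (e.1.symm q.1, q.2)))
      {q | q.1 ∈ e.1.target ∧ e.1.symm q.1 ∈ (triv i).baseSet ∧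
        (triv i).toOpenPartialHomeomorph.symm (e.1.symm q.1, q.2) ∈ (𝒜.chart a).source}
  /-- the vector space structures of the fibres -/
  [fibreAdd : ∀ x : M, AddCommGroup {p : X // π p = x}]
  [fibreModule : ∀ x : M, Module ℝ {p : X // π p = x}]
  linear : ∀ i, ∀ x ∈ (triv i).baseSet,
    IsLinearMap ℝ (fun p : {p : X // π p = x} => (triv i p.1).2)
  transition : ι → ι → M → AutLim E
  transition_smooth : ∀ (i j : ι) (e : SmoothChart E M),
    FrechetSmoothOn (fun y : E => autLimToEndLim (transition i j (e.1.symm y)))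
      {y | y ∈ e.1.target ∧ e.1.symm y ∈ (triv i).baseSet ∧ e.1.symm y ∈ (triv j).baseSet}
  transition_spec : ∀ i j, ∀ p : X, π p ∈ (triv i).baseSet → π p ∈ (triv j).baseSet →
    (triv j p).2 = autLimAct (transition i j (π p)) (triv i p).2
  cocycle : ∀ i j k, ∀ x : M, x ∈ (triv i).baseSet → x ∈ (triv j).baseSet →
    x ∈ (triv k).baseSet → transition j k x * transition i j x = transition i k x

end Tangent

end

/-! Let `c` be a curve in a chart, with Taylor coefficients u_j, let v_m be the Taylor coefficients
of c', and put w_n = ∑_{l ≤ n} M^l(c) v_(n-l). The recursion defining M^l is exactly what makes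
(n+1) w_(n+1) = w_n' + Γ(c, c') w_n hold (`hasDerivAt_covCoeff`). So w_n is 1/n! times the n-th
covariant derivative of c' along c, and z^(n+1) = w_n / (n+1). Covariant derivatives are tensorial:
by induction on n, the transformation rule of Γ turns w_n into dφ(c) w_n under a change of charts φ
(`covCoeff_comp`). Jet coordinates transform nonlinearly, by the higher chain rule, but the
coordinates z transform by (x, z^1, …, z^k) ↦ (φ(x), dφ(x) z^1, …, dφ(x) z^k), which is linear and
diagonal in the fibre (`LinearConnection.chart_eq`).

The passage from u to z loses nothing: z^i is u_i plus a smooth function of u_0, …, u_(i-1), so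
`zMap` is triangular, has a smooth inverse (`contDiffOn_zInv`) and commutes with truncation.
Injectivity of the charts on classes of curves follows. Surjectivity, at finite and at infinite
order, is Borel's lemma (`exists_contDiff_taylorCoeff_eq`): every sequence in E is the Taylor
sequence of a smooth curve. It also shows that every thread of the T^k M comes from a single curve.

The limit is then handled one level at a time. The limit spaces are closed subspaces of countable
products of Banach spaces. A map into such a subspace is C^n once its components are
(`frechetCkOn_of_components`), and each component that occurs is a smooth map of Banach spaces
composed with a continuous linear projection (`frechetCkOn_of_contDiffOn`). The transition functions
let the single operator dφ(x) act diagonally at every level. Since L ↦ (L, …, L) is continuous and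
linear in operator norm, they are smooth into lim H_i; the cocycle condition is the chain rule. -/

/-! ## Taylor coefficients of curves and the components of a connection -/

section Calculus

variable {E : Type u} [NormedAddCommGroup E] [NormedSpace ℝ E]

/-- The `j`-th Taylor coefficient of the curve `c` at time `t`. -/
noncomputable def taylorCoeff (c : ℝ → E) (j : ℕ) (t : ℝ) : E :=
  ((Nat.factorial j : ℝ))⁻¹ • iteratedDeriv j c t

/-- The `k`-jet of the curve `c` at time `t`, given by its Taylor coefficients. -/
noncomputable def curveJet (c : ℝ → E) (k : ℕ) (t : ℝ) : Fin (k + 1) → E :=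
  fun j => taylorCoeff c j t

@[simp] lemma taylorCoeff_zero (c : ℝ → E) (t : ℝ) : taylorCoeff c 0 t = c t := by
  simp [taylorCoeff]

@[simp] lemma taylorCoeff_one (c : ℝ → E) (t : ℝ) : taylorCoeff c 1 t = deriv c t := by
  simp [taylorCoeff]

@[simp] lemma curveJet_zero (c : ℝ → E) (k : ℕ) (t : ℝ) : curveJet c k t 0 = c t := by
  simp [curveJet]

lemma contDiffOn_iteratedDeriv {I : Set ℝ} (hI : IsOpen I) {c : ℝ → E}
    (hc : ContDiffOn ℝ ∞ c I) (n : ℕ) : ContDiffOn ℝ ∞ (iteratedDeriv n c) I := by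
  induction n with
  | zero => simpa using hc
  | succ n ih =>
    rw [iteratedDeriv_succ]
    exact ih.deriv_of_isOpen hI (by simp)

lemma contDiffOn_taylorCoeff {I : Set ℝ} (hI : IsOpen I) {c : ℝ → E}
    (hc : ContDiffOn ℝ ∞ c I) (n : ℕ) : ContDiffOn ℝ ∞ (taylorCoeff c n) I :=
  (contDiffOn_iteratedDeriv hI hc n).const_smul _

/-- The factor n + 1 comes from the normalization by 1/n!. It is the source of the weights i in the
directions i ξ_i of the recursion for M^l. -/
lemma hasDerivAt_taylorCoeff {I : Set ℝ} (hI : IsOpen I) {c : ℝ → E}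
    (hc : ContDiffOn ℝ ∞ c I) (n : ℕ) {t : ℝ} (ht : t ∈ I) :
    HasDerivAt (taylorCoeff c n) (((n : ℝ) + 1) • taylorCoeff c (n + 1) t) t := by
  have h : HasDerivAt (iteratedDeriv n c) (iteratedDeriv (n + 1) c t) t := by
    rw [iteratedDeriv_succ]
    exact (((contDiffOn_iteratedDeriv hI hc n).differentiableOn (by simp)).differentiableAt
      (hI.mem_nhds ht)).hasDerivAt
  refine (h.const_smul ((Nat.factorial n : ℝ))⁻¹).congr_deriv ?_
  rw [taylorCoeff, smul_smul]
  congr 1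
  rw [Nat.factorial_succ]
  push_cast
  field_simp

lemma curveJet_castSucc (c : ℝ → E) (l : ℕ) (t : ℝ) :
    (fun i : Fin (l + 1) => curveJet c (l + 1) t i.castSucc) = curveJet c l t := by
  funext i
  simp [curveJet]

lemma isOpen_base_preimage {E : Type u} [NormedAddCommGroup E] {U : Set E} (hU : IsOpen U) (k : ℕ) :
    IsOpen {u : Fin (k + 1) → E | u 0 ∈ U} :=
  hU.preimage (continuous_apply 0)

/-- Induction on l: the step involves the derivative of M^l, which costs nothing at order ∞ because
the domain, a condition on u_0 alone, is open. -/
lemma contDiffOn_connComp {U : Set E} (hU : IsOpen U) {Γ : E → E →L[ℝ] E →L[ℝ] E}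
    (hΓ : ContDiffOn ℝ ∞ Γ U) (l : ℕ) :
    ContDiffOn ℝ ∞ (connComp Γ l) {u : Fin (l + 1) → E | u 0 ∈ U} := by
  induction l with
  | zero => exact contDiffOn_const
  | succ l ih =>
    have hinit : ContDiff ℝ ∞ (fun u : Fin (l + 2) → E => fun i : Fin (l + 1) => u i.castSucc) :=
      contDiff_pi.2 fun i => contDiff_apply ℝ E _
    have hmaps : MapsTo (fun u : Fin (l + 2) → E => fun i : Fin (l + 1) => u i.castSucc)
        {u : Fin (l + 2) → E | u 0 ∈ U} {u : Fin (l + 1) → E | u 0 ∈ U} := fun u hu => hu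
    have h1 := (ih.fderiv_of_isOpen (m := ∞) (isOpen_base_preimage hU l) (by simp)).comp
      hinit.contDiffOn hmaps
    have h2 : ContDiff ℝ ∞ (fun u : Fin (l + 2) → E =>
        fun i : Fin (l + 1) => (((i : ℕ) : ℝ) + 1) • u i.succ) :=
      contDiff_pi.2 fun i => (contDiff_apply ℝ E _).const_smul _
    have h3 := ih.comp hinit.contDiffOn hmaps
    have h4 : ContDiffOn ℝ ∞ (fun u : Fin (l + 2) → E => Γ (u 0)) {u | u 0 ∈ U} :=
      hΓ.comp (contDiff_apply ℝ E (0 : Fin (l + 2))).contDiffOn fun u hu => hu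
    have h5 := h4.clm_apply (contDiff_apply ℝ E (1 : Fin (l + 2))).contDiffOn
    exact ((h1.clm_apply h2.contDiffOn).add (h5.clm_comp h3)).const_smul _

/-- The operator-valued curve `M^l` along `c` satisfies
`(l + 1) M^(l+1) = (M^l)' + Γ(c, c') M^l`. -/
lemma hasDerivAt_connComp_curveJet {U : Set E} (hU : IsOpen U) {Γ : E → E →L[ℝ] E →L[ℝ] E}
    (hΓ : ContDiffOn ℝ ∞ Γ U) {I : Set ℝ} (hI : IsOpen I) {c : ℝ → E}
    (hc : ContDiffOn ℝ ∞ c I) (hcU : MapsTo c I U) (l : ℕ) {t : ℝ} (ht : t ∈ I) :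
    HasDerivAt (fun s => connComp Γ l (curveJet c l s))
      (((l : ℝ) + 1) • connComp Γ (l + 1) (curveJet c (l + 1) t) -
        (Γ (c t) (deriv c t)).comp (connComp Γ l (curveJet c l t))) t := by
  -- The velocity of the jet curve is (ξ_1, 2 ξ_2, …, (l+1) ξ_(l+1)), the direction in which the
  -- recursion differentiates M^l. The chain rule thus yields precisely its derivative term.
  have h1 : HasDerivAt (curveJet c l)
      (fun i : Fin (l + 1) => (((i : ℕ) : ℝ) + 1) • curveJet c (l + 1) t i.succ) t :=
    hasDerivAt_pi.2 fun i => by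
      simpa [curveJet] using hasDerivAt_taylorCoeff hI hc i ht
  have h2 : DifferentiableAt ℝ (connComp Γ l) (curveJet c l t) :=
    ((contDiffOn_connComp hU hΓ l).differentiableOn (by simp)).differentiableAt
      ((isOpen_base_preimage hU l).mem_nhds (by simpa using hcU ht))
  refine (h2.hasFDerivAt.comp_hasDerivAt t h1).congr_deriv ?_
  have h3 : ((l : ℝ) + 1) ≠ 0 := by positivity
  rw [connComp, smul_smul, mul_inv_cancel₀ h3, one_smul, curveJet_castSucc]
  have h4 : curveJet c (l + 1) t 1 = deriv c t := by
    simp [curveJet]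
  rw [h4, curveJet_zero, add_sub_cancel_right]

/-- The curve `∑_{l ≤ n} M^l(c) v_(n-l)`, where `v_m` are the Taylor coefficients of `c'`. It is
`1 / n!` times the `n`-th covariant derivative of `c'` along `c`. -/
noncomputable def covCoeff (Γ : E → E →L[ℝ] E →L[ℝ] E) (c : ℝ → E) (n : ℕ) (t : ℝ) : E :=
  ∑ l ∈ Finset.range (n + 1), connComp Γ l (curveJet c l t)
    (((n - l + 1 : ℕ) : ℝ) • taylorCoeff c (n - l + 1) t)

/-- This links the algebraic map `zMap` to covariant differentiation: on jets of curves, its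
components are rescaled covariant derivatives of the velocity. -/
lemma zMap_curveJet_succ (Γ : E → E →L[ℝ] E →L[ℝ] E) (c : ℝ → E) (k : ℕ) (t : ℝ) (i : Fin k) :
    zMap Γ k (curveJet c k t) i.succ = ((i : ℝ) + 1)⁻¹ • covCoeff Γ c i t := by
  simp only [zMap, Fin.val_succ, Nat.succ_ne_zero, if_false, covCoeff]
  push_cast
  congr 1
  rw [Finset.sum_range]
  refine Finset.sum_congr rfl fun l _ => ?_
  have hl : (l : ℕ) ≤ i := Nat.lt_succ_iff.1 l.2
  have h1 : (i : ℕ) + 1 - l = i - l + 1 := by omega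
  rw [← Nat.cast_succ, ← h1]
  simp only [curveJet, h1]
  rfl

/-- `(n + 1) w_(n+1) = w_n' + Γ(c, c') w_n` for `w_n = covCoeff Γ c n`. -/
lemma hasDerivAt_covCoeff {U : Set E} (hU : IsOpen U) {Γ : E → E →L[ℝ] E →L[ℝ] E}
    (hΓ : ContDiffOn ℝ ∞ Γ U) {I : Set ℝ} (hI : IsOpen I) {c : ℝ → E}
    (hc : ContDiffOn ℝ ∞ c I) (hcU : MapsTo c I U) (n : ℕ) {t : ℝ} (ht : t ∈ I) :
    HasDerivAt (covCoeff Γ c n)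
      (((n : ℝ) + 1) • covCoeff Γ c (n + 1) t - Γ (c t) (deriv c t) (covCoeff Γ c n t)) t := by
  have h : HasDerivAt (covCoeff Γ c n) (∑ l ∈ Finset.range (n + 1), _) t :=
    HasDerivAt.fun_sum fun l _ =>
      (hasDerivAt_connComp_curveJet hU hΓ hI hc hcU l ht).clm_apply
        ((hasDerivAt_taylorCoeff hI hc (n - l + 1) ht).const_smul ((n - l + 1 : ℕ) : ℝ))
  convert h using 1
  set A : ℕ → E →L[ℝ] E := fun l => connComp Γ l (curveJet c l t) with hA
  set T : ℕ → E := fun j => taylorCoeff c j t with hT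
  simp only [sub_apply, smul_apply,
    ContinuousLinearMap.comp_apply, sub_add_eq_add_sub]
  rw [Finset.sum_sub_distrib, covCoeff, covCoeff, map_sum]
  congr 1
  rw [Finset.sum_add_distrib]
  -- With v_m = (m+1) T_(m+1), the part (l+1) M^(l+1) v_(n-l) is reindexed to weight l on M^l
  -- v_(n+1-l); the new term l = 0 vanishes.
  have e1 : ∑ l ∈ Finset.range (n + 1), ((l : ℝ) + 1) •
        A (l + 1) (((n - l + 1 : ℕ) : ℝ) • T (n - l + 1)) =
      ∑ l ∈ Finset.range (n + 2), (l : ℝ) • A l (((n + 1 - l + 1 : ℕ) : ℝ) • T (n + 1 - l + 1)) := by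
    rw [Finset.sum_range_succ' _ (n + 1)]
    simp [Nat.add_sub_add_right]
  -- Since v_m' = (m+1) v_(m+1), the part M^l v_(n-l)' has weight n+1-l on M^l v_(n+1-l), and the
  -- added term l = n+1 vanishes. The two weights add up to n+1, independently of l.
  have e2 : ∑ l ∈ Finset.range (n + 1),
        A l (((n - l + 1 : ℕ) : ℝ) • (((n - l + 1 : ℕ) : ℝ) + 1) • T (n - l + 1 + 1)) =
      ∑ l ∈ Finset.range (n + 2), ((n : ℝ) + 1 - l) •
        A l (((n + 1 - l + 1 : ℕ) : ℝ) • T (n + 1 - l + 1)) := by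
    rw [Finset.sum_range_succ _ (n + 1)]
    have : ((n : ℝ) + 1 - ((n + 1 : ℕ) : ℝ)) = 0 := by push_cast; ring
    rw [this, zero_smul, add_zero]
    refine Finset.sum_congr rfl fun l hl => ?_
    have hl : l ≤ n := Nat.lt_succ_iff.1 (Finset.mem_range.1 hl)
    obtain ⟨m, rfl⟩ := Nat.exists_eq_add_of_le hl
    have h1 : l + m - l = m := by omega
    have h2 : l + m + 1 - l = m + 1 := by omega
    rw [h1, h2, map_smul, map_smul, map_smul, smul_smul, smul_smul]
    congr 1
    push_cast
    ring
  refine Eq.trans ?_ (congrArg₂ (· + ·) e1 e2).symm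
  rw [← Finset.sum_add_distrib, Finset.smul_sum]
  refine Finset.sum_congr rfl fun l _ => ?_
  rw [← add_smul]
  congr 1
  ring

lemma covCoeff_zero (Γ : E → E →L[ℝ] E →L[ℝ] E) (c : ℝ → E) (t : ℝ) :
    covCoeff Γ c 0 t = deriv c t := by
  simp [covCoeff, connComp]

/-- Covariance: under a change of charts `φ` that transforms `Γ` into `Γ'`, the curves
`covCoeff` transform by `dφ`. -/
lemma covCoeff_comp {U U' : Set E} (hU : IsOpen U) (hU' : IsOpen U')
    {Γ Γ' : E → E →L[ℝ] E →L[ℝ] E} (hΓ : ContDiffOn ℝ ∞ Γ U) (hΓ' : ContDiffOn ℝ ∞ Γ' U')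
    {φ : E → E} (hφ : ContDiffOn ℝ ∞ φ U) (hφU : MapsTo φ U U')
    (hcomp : ∀ x ∈ U, ∀ ξ y : E, fderiv ℝ φ x (Γ x ξ y) =
      fderiv ℝ (fderiv ℝ φ) x ξ y + Γ' (φ x) (fderiv ℝ φ x ξ) (fderiv ℝ φ x y))
    {I : Set ℝ} (hI : IsOpen I) {c : ℝ → E} (hc : ContDiffOn ℝ ∞ c I) (hcU : MapsTo c I U)
    (n : ℕ) : ∀ t ∈ I, covCoeff Γ' (φ ∘ c) n t = fderiv ℝ φ (c t) (covCoeff Γ c n t) := by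
  have hdc : ∀ t ∈ I, HasDerivAt c (deriv c t) t := fun t ht =>
    ((hc.differentiableOn (by simp)).differentiableAt (hI.mem_nhds ht)).hasDerivAt
  have hdφ : ∀ x ∈ U, HasFDerivAt φ (fderiv ℝ φ x) x := fun x hx =>
    ((hφ.differentiableOn (by simp)).differentiableAt (hU.mem_nhds hx)).hasFDerivAt
  have hd2φ : ∀ x ∈ U, HasFDerivAt (fderiv ℝ φ) (fderiv ℝ (fderiv ℝ φ) x) x := fun x hx =>
    (((hφ.fderiv_of_isOpen (m := ∞) hU (by simp)).differentiableOn (by simp)).differentiableAt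
      (hU.mem_nhds hx)).hasFDerivAt
  have hderiv : ∀ t ∈ I, deriv (φ ∘ c) t = fderiv ℝ φ (c t) (deriv c t) := fun t ht =>
    ((hdφ _ (hcU ht)).comp_hasDerivAt t (hdc t ht)).deriv
  induction n with
  | zero =>
    intro t ht
    rw [covCoeff_zero, covCoeff_zero, hderiv t ht]
  | succ n ih =>
    intro t ht
    -- Both sides of the induction hypothesis are differentiated in t, which is why the claim is
    -- made for all t in the open set I. The product rule on the right produces d²φ(c', w_n), which
    -- the transformation rule of Γ cancels.
    have h1 := hasDerivAt_covCoeff hU' hΓ' hI (hφ.comp hc hcU) (hφU.comp hcU) n ht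
    have h2 := ((hd2φ _ (hcU ht)).comp_hasDerivAt t (hdc t ht)).clm_apply
      (hasDerivAt_covCoeff hU hΓ hI hc hcU n ht)
    have h3 := h1.unique (h2.congr_of_eventuallyEq
      (Filter.eventually_of_mem (hI.mem_nhds ht) fun s hs => ih s hs))
    have h4 := hcomp _ (hcU ht) (deriv c t) (covCoeff Γ c n t)
    simp only [Function.comp_apply] at h3
    rw [hderiv t ht, ih t ht, map_sub, map_smul, h4, sub_eq_iff_eq_add] at h3
    have h5 : ((n : ℝ) + 1) ≠ 0 := by positivity
    apply smul_right_injective E h5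
    simp only [h3]
    abel

lemma zMap_zero (Γ : E → E →L[ℝ] E →L[ℝ] E) (k : ℕ) (u : Fin (k + 1) → E) :
    zMap Γ k u 0 = u 0 := by
  simp [zMap]

lemma zMap_curveJet_comp {U U' : Set E} (hU : IsOpen U) (hU' : IsOpen U')
    {Γ Γ' : E → E →L[ℝ] E →L[ℝ] E} (hΓ : ContDiffOn ℝ ∞ Γ U) (hΓ' : ContDiffOn ℝ ∞ Γ' U')
    {φ : E → E} (hφ : ContDiffOn ℝ ∞ φ U) (hφU : MapsTo φ U U')
    (hcomp : ∀ x ∈ U, ∀ ξ y : E, fderiv ℝ φ x (Γ x ξ y) =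
      fderiv ℝ (fderiv ℝ φ) x ξ y + Γ' (φ x) (fderiv ℝ φ x ξ) (fderiv ℝ φ x y))
    {I : Set ℝ} (hI : IsOpen I) {c : ℝ → E} (hc : ContDiffOn ℝ ∞ c I) (hcU : MapsTo c I U)
    (k : ℕ) {t : ℝ} (ht : t ∈ I) :
    zMap Γ' k (curveJet (φ ∘ c) k t) =
      Fin.cons (φ (c t)) fun i => fderiv ℝ φ (c t) (zMap Γ k (curveJet c k t) i.succ) := by
  funext i
  refine Fin.cases ?_ (fun i => ?_) i
  · rw [zMap_zero, curveJet_zero, Fin.cons_zero, Function.comp_apply]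
  · rw [Fin.cons_succ, zMap_curveJet_succ, zMap_curveJet_succ, map_smul,
      covCoeff_comp hU hU' hΓ hΓ' hφ hφU hcomp hI hc hcU i t ht]

/-! ## The triangular map `zMap` is a diffeomorphism -/

/-- It holds by definition: the i-th component uses only u_0, …, u_i and does not see k. This is
what makes the charts of different orders compatible. -/
lemma zMap_truncate (Γ : E → E →L[ℝ] E →L[ℝ] E) {k m : ℕ} (h : k ≤ m) (u : Fin (m + 1) → E) :
    truncate E (Nat.add_le_add_right h 1) (zMap Γ m u) =
      zMap Γ k (truncate E (Nat.add_le_add_right h 1) u) := by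
  rfl

lemma zMap_succ_castSucc (Γ : E → E →L[ℝ] E →L[ℝ] E) {k : ℕ} (u : Fin (k + 2) → E)
    (i : Fin (k + 1)) : zMap Γ (k + 1) u i.castSucc = zMap Γ k (fun j => u j.castSucc) i := by
  rfl

/-- Triangularity: the top coefficient enters only through the term l = 0, where M^0 = id and the
factors k+1 and 1/(k+1) cancel. All terms with l ≥ 1 involve lower coefficients only. -/
lemma zMap_snoc_last (Γ : E → E →L[ℝ] E →L[ℝ] E) {k : ℕ} (u : Fin (k + 1) → E) (a : E) :
    zMap Γ (k + 1) (Fin.snoc (α := fun _ => E) u a) (Fin.last (k + 1)) =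
      a + zMap Γ (k + 1) (Fin.snoc (α := fun _ => E) u 0) (Fin.last (k + 1)) := by
  have key : ∀ b : E, zMap Γ (k + 1) (Fin.snoc (α := fun _ => E) u b) (Fin.last (k + 1)) =
      b + (((k + 1 : ℕ) : ℝ))⁻¹ • ∑ l : Fin k, connComp Γ (l + 1)
        (fun j => u ⟨j, by omega⟩) (((k - l : ℕ) : ℝ) • u ⟨k - l, by omega⟩) := by
    intro b
    have h0 : ((k + 1 : ℕ) : ℝ) ≠ 0 := by positivity
    simp only [zMap, Fin.val_last, Nat.succ_ne_zero, if_false]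
    rw [Fin.sum_univ_succ, smul_add]
    congr 1
    · have : (⟨k + 1 - ((0 : Fin (k + 1)) : ℕ), by simp⟩ : Fin (k + 2)) = Fin.last (k + 1) := by
        ext; simp
      simp only [Fin.val_zero, connComp, ContinuousLinearMap.id_apply, Nat.sub_zero]
      have e : (⟨k + 1, by omega⟩ : Fin (k + 2)) = Fin.last (k + 1) := rfl
      rw [e, Fin.snoc_last, smul_smul, inv_mul_cancel₀ h0, one_smul]
    · congr 1
      refine Finset.sum_congr rfl fun l _ => ?_
      have e1 : (fun j : Fin ((l.succ : ℕ) + 1) => Fin.snoc (α := fun _ => E) u b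
          (⟨j, by have := j.2; have := l.succ.2; omega⟩ : Fin (k + 2))) =
          fun j : Fin ((l.succ : ℕ) + 1) => u ⟨j, by have := j.2; have := l.succ.2; omega⟩ := by
        funext j
        have hj : (j : ℕ) < k + 1 := by have := j.2; have := l.succ.2; omega
        exact Fin.snoc_castSucc (α := fun _ => E) b u ⟨j, hj⟩
      have h2 : k + 1 - (l.succ : ℕ) = k - l := by simp
      have e2 : ∀ (m : ℕ) (hm : m = k - l) (hm' : m < k + 2), (m : ℝ) •
          Fin.snoc (α := fun _ => E) u b ⟨m, hm'⟩ =
          ((k - l : ℕ) : ℝ) • u ⟨k - l, by omega⟩ := by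
        rintro m rfl hm'
        congr 1
        exact Fin.snoc_castSucc (α := fun _ => E) b u ⟨k - l, by omega⟩
      rw [e1, e2 _ h2]
      rfl
  rw [key a, key 0, zero_add]

/-- The inverse of `zMap`. -/
noncomputable def zInv (Γ : E → E →L[ℝ] E →L[ℝ] E) : (k : ℕ) → (Fin (k + 1) → E) → Fin (k + 1) → E
  | 0, z => z
  | k + 1, z =>
    Fin.snoc (α := fun _ => E) (zInv Γ k fun i => z i.castSucc)
      (z (Fin.last (k + 1)) - zMap Γ (k + 1)
        (Fin.snoc (α := fun _ => E) (zInv Γ k fun i => z i.castSucc) 0) (Fin.last (k + 1)))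

lemma zMap_zInv (Γ : E → E →L[ℝ] E →L[ℝ] E) (k : ℕ) (z : Fin (k + 1) → E) :
    zMap Γ k (zInv Γ k z) = z := by
  induction k with
  | zero =>
    funext i
    rw [show i = 0 from Fin.fin_one_eq_zero i, zMap_zero, zInv]
  | succ k ih =>
    funext i
    refine Fin.lastCases ?_ (fun i => ?_) i
    · rw [zInv, zMap_snoc_last, sub_add_cancel]
    · rw [zMap_succ_castSucc, zInv]
      simp only [Fin.snoc_castSucc]
      rw [ih]

lemma zInv_zMap (Γ : E → E →L[ℝ] E →L[ℝ] E) (k : ℕ) (u : Fin (k + 1) → E) :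
    zInv Γ k (zMap Γ k u) = u := by
  induction k with
  | zero =>
    funext i
    rw [show i = 0 from Fin.fin_one_eq_zero i, zInv, zMap_zero]
  | succ k ih =>
    have h1 : zInv Γ k (fun i => zMap Γ (k + 1) u i.castSucc) = Fin.init u := by
      simp only [zMap_succ_castSucc]
      exact ih _
    have h2 := zMap_snoc_last Γ (Fin.init u) (u (Fin.last (k + 1)))
    rw [Fin.snoc_init_self] at h2
    rw [zInv, h1, h2, add_sub_cancel_right, Fin.snoc_init_self]

lemma zInv_zero (Γ : E → E →L[ℝ] E →L[ℝ] E) (k : ℕ) (z : Fin (k + 1) → E) :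
    zInv Γ k z 0 = z 0 := by
  rw [← zMap_zero Γ k (zInv Γ k z), zMap_zInv]

lemma contDiffOn_zMap {U : Set E} (hU : IsOpen U) {Γ : E → E →L[ℝ] E →L[ℝ] E}
    (hΓ : ContDiffOn ℝ ∞ Γ U) (k : ℕ) :
    ContDiffOn ℝ ∞ (zMap Γ k) {u : Fin (k + 1) → E | u 0 ∈ U} := by
  refine contDiffOn_pi.2 fun i => ?_
  by_cases hi : (i : ℕ) = 0
  · simp only [zMap, hi, if_true]
    exact (contDiff_apply ℝ E _).contDiffOn
  · simp only [zMap, hi, if_false]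
    refine (ContDiffOn.sum fun l _ => ?_).const_smul _
    refine ContDiffOn.clm_apply ?_ ((contDiff_apply ℝ E _).const_smul _).contDiffOn
    exact (contDiffOn_connComp hU hΓ l).comp
      (contDiff_pi.2 fun j => contDiff_apply ℝ E _).contDiffOn fun u hu => hu

/-- Induction on k along the recursion: the new last coordinate is z_(k+1) minus a smooth function
of the coordinates already solved for, so no inverse function theorem is needed. -/
lemma contDiffOn_zInv {U : Set E} (hU : IsOpen U) {Γ : E → E →L[ℝ] E →L[ℝ] E}
    (hΓ : ContDiffOn ℝ ∞ Γ U) (k : ℕ) :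
    ContDiffOn ℝ ∞ (zInv Γ k) {u : Fin (k + 1) → E | u 0 ∈ U} := by
  induction k with
  | zero => exact contDiff_id.contDiffOn
  | succ k ih =>
    have h1 : ContDiffOn ℝ ∞ (fun z : Fin (k + 2) → E => zInv Γ k fun i => z i.castSucc)
        {z | z 0 ∈ U} :=
      ih.comp (contDiff_pi.2 fun i => contDiff_apply ℝ E _).contDiffOn fun u hu => hu
    have h2 : ContDiffOn ℝ ∞ (fun z : Fin (k + 2) → E =>
        Fin.snoc (α := fun _ => E) (zInv Γ k fun i => z i.castSucc) (0 : E)) {z | z 0 ∈ U} := by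
      refine contDiffOn_pi.2 fun i => Fin.lastCases ?_ (fun i => ?_) i
      · simp only [Fin.snoc_last]
        exact contDiffOn_const
      · simp only [Fin.snoc_castSucc]
        exact contDiffOn_pi.1 h1 i
    have h3 := contDiffOn_pi.1 ((contDiffOn_zMap hU hΓ (k + 1)).comp h2 fun z hz => by
      change Fin.snoc (α := fun _ => E) (zInv Γ k fun i => z i.castSucc) (0 : E) (0 : Fin (k + 2)) ∈ U
      rw [← Fin.castSucc_zero, Fin.snoc_castSucc, zInv_zero]
      exact hz) (Fin.last (k + 1))
    refine contDiffOn_pi.2 fun i => Fin.lastCases ?_ (fun i => ?_) i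
    · simp only [zInv, Fin.snoc_last]
      exact (contDiff_apply ℝ E _).contDiffOn.sub h3
    · simp only [zInv, Fin.snoc_castSucc]
      exact contDiffOn_pi.1 h1 i

/-- `zMap` as a homeomorphism of the open set `{u | u 0 ∈ U}` onto itself. -/
noncomputable def zHomeo {U : Set E} (hU : IsOpen U) {Γ : E → E →L[ℝ] E →L[ℝ] E}
    (hΓ : ContDiffOn ℝ ∞ Γ U) (k : ℕ) :
    OpenPartialHomeomorph (Fin (k + 1) → E) (Fin (k + 1) → E) where
  toFun := zMap Γ k
  invFun := zInv Γ k
  source := {u | u 0 ∈ U}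
  target := {u | u 0 ∈ U}
  map_source' u hu := by rwa [mem_ofPred_eq, zMap_zero]
  map_target' u hu := by rwa [mem_ofPred_eq, zInv_zero]
  left_inv' u _ := zInv_zMap Γ k u
  right_inv' u _ := zMap_zInv Γ k u
  open_source := isOpen_base_preimage hU k
  open_target := isOpen_base_preimage hU k
  continuousOn_toFun := (contDiffOn_zMap hU hΓ k).continuousOn
  continuousOn_invFun := (contDiffOn_zInv hU hΓ k).continuousOn

end Calculus

/-! ## Borel's lemma -/

section Borel

variable {E : Type u} [NormedAddCommGroup E] [NormedSpace ℝ E]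

lemma iteratedDeriv_pow_smul_zero (a : E) (m n : ℕ) :
    iteratedDeriv m (fun t : ℝ => t ^ n • a) 0 = if m = n then (Nat.factorial m : ℝ) • a else 0 := by
  have h : (fun t : ℝ => t ^ n • a) =
      fun t => (ContinuousLinearMap.toSpanSingleton ℝ a) (t ^ n) := by
    funext t
    simp
  have h2 := (ContinuousLinearMap.toSpanSingleton ℝ a).iteratedFDeriv_comp_left (x := (0 : ℝ))
    (f := fun t : ℝ => t ^ n) (contDiff_id.pow n).contDiffAt (i := m) (n := m) le_rfl
  rw [iteratedDeriv_eq_iteratedFDeriv, h]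
  have h3 := congrArg (fun L => L fun _ => (1 : ℝ)) h2
  refine h3.trans ?_
  rw [ContinuousLinearMap.compContinuousMultilinearMap_coe, Function.comp_apply,
    ← iteratedDeriv_eq_iteratedFDeriv, iteratedDeriv_fun_pow_zero]
  split_ifs <;> simp_all

lemma exists_bound_iteratedFDeriv {g : ℝ → E} (hg : ContDiff ℝ ∞ g) (hs : HasCompactSupport g)
    (m : ℕ) : ∃ B : ℝ, ∀ t, ‖iteratedFDeriv ℝ m g t‖ ≤ B :=
  (hs.iteratedFDeriv m).exists_bound_of_continuous
    (hg.continuous_iteratedFDeriv (by exact_mod_cast le_top))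

variable [CompleteSpace E]

/-- Borel's lemma: every sequence in a Banach space is the sequence of Taylor coefficients at `0` of
a smooth curve. -/
theorem exists_contDiff_taylorCoeff_eq (a : ℕ → E) :
    ∃ c : ℝ → E, ContDiff ℝ ∞ c ∧ ∀ m, taylorCoeff c m 0 = a m := by
  let ρ : ContDiffBump (0 : ℝ) := ⟨1, 2, one_pos, one_lt_two⟩
  -- The monomial t^n a_n is cut off to compact support, which bounds all its derivatives; near 0 it
  -- is unchanged.
  let g : ℕ → ℝ → E := fun n t => ρ t • (t ^ n • a n)
  have hg : ∀ n, ContDiff ℝ ∞ (g n) := fun n =>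
    ρ.contDiff.smul ((contDiff_id.pow n).smul contDiff_const)
  have hgs : ∀ n, HasCompactSupport (g n) := fun n => ρ.hasCompactSupport.smul_right
  choose B hB using fun n m => exists_bound_iteratedFDeriv (hg n) (hgs n) m
  have hB0 : ∀ n m, 0 ≤ B n m := fun n m => (norm_nonneg _).trans (hB n m 0)
  -- R n dominates 2^n B n m for every m < n and is at least 1. Rescaling time by R n then makes all
  -- derivatives of order m < n of the n-th summand at most 2^(-n).
  let R : ℕ → ℝ := fun n => 1 + 2 ^ n * ∑ m ∈ Finset.range n, B n m
  have hR1 : ∀ n, 1 ≤ R n := fun n => by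
    have : 0 ≤ 2 ^ n * ∑ m ∈ Finset.range n, B n m :=
      mul_nonneg (by positivity) (Finset.sum_nonneg fun m _ => hB0 n m)
    simp only [R]
    linarith
  have hR0 : ∀ n, 0 < R n := fun n => one_pos.trans_le (hR1 n)
  have hRB : ∀ n m, m < n → 2 ^ n * B n m ≤ R n := fun n m h => by
    have : B n m ≤ ∑ m ∈ Finset.range n, B n m :=
      Finset.single_le_sum (f := fun m => B n m) (fun m _ => hB0 n m) (Finset.mem_range.2 h)
    have h2 : (0 : ℝ) < 2 ^ n := by positivity
    have := mul_le_mul_of_nonneg_left this h2.le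
    simp only [R]
    linarith
  -- The prefactor R^(-n) undoes the rescaling of the monomial, so f n is still t^n a_n near 0,
  -- whereas its m-th derivative is scaled by R^(m-n).
  let f : ℕ → ℝ → E := fun n t => ((R n) ^ n)⁻¹ • g n (R n * t)
  have hf : ∀ n, ContDiff ℝ ∞ (f n) := fun n =>
    ((hg n).comp (contDiff_const.mul contDiff_id)).const_smul _
  have hfd : ∀ m n t, ‖iteratedFDeriv ℝ m (f n) t‖ ≤ (R n ^ n)⁻¹ * (R n ^ m * B n m) := by
    intro m n t
    rw [norm_iteratedFDeriv_eq_norm_iteratedDeriv]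
    have h1 : ContDiff ℝ m (g n) := (hg n).of_le (by exact_mod_cast le_top)
    have h2 : ContDiff ℝ m (fun t => g n (R n * t)) := h1.comp (contDiff_const.mul contDiff_id)
    have h3 : iteratedDeriv m (f n) t =
        (R n ^ n)⁻¹ • (R n ^ m • iteratedDeriv m (g n) (R n * t)) := by
      have := iteratedDeriv_const_smul (h2.contDiffAt (x := t)) ((R n ^ n)⁻¹)
      rw [iteratedDeriv_comp_const_smul h1] at this
      exact this
    rw [h3, norm_smul, norm_smul, ← norm_iteratedFDeriv_eq_norm_iteratedDeriv,
      Real.norm_of_nonneg (by have := hR0 n; positivity),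
      Real.norm_of_nonneg (by have := hR0 n; positivity)]
    have := hR0 n
    gcongr
    exact hB n m _
  -- For fixed m, the geometric bound can fail only for the finitely many n ≤ m; there the crude
  -- bound is added, which does not affect summability.
  let v : ℕ → ℕ → ℝ := fun m n => (1 / 2) ^ n +
    if n ∈ Finset.range (m + 1) then (R n ^ n)⁻¹ * (R n ^ m * B n m) else 0
  have hv : ∀ m, Summable (v m) := fun m =>
    (summable_geometric_of_lt_one (by norm_num) (by norm_num)).add
      (summable_of_ne_finset_zero (s := Finset.range (m + 1)) fun n hn => if_neg hn)
  have hfv : ∀ m n t, ‖iteratedFDeriv ℝ m (f n) t‖ ≤ v m n := by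
    intro m n t
    refine (hfd m n t).trans ?_
    by_cases h : n ∈ Finset.range (m + 1)
    · simp only [v, if_pos h]
      have : (0 : ℝ) ≤ (1 / 2) ^ n := by positivity
      linarith
    · simp only [v, if_neg h, add_zero]
      have hmn : m < n := by simpa using h
      have h1 : R n ^ m * R n ≤ R n ^ n := by
        rw [← pow_succ]
        exact pow_le_pow_right₀ (hR1 n) hmn
      have h2 := hRB n m hmn
      have h3 : (0 : ℝ) < R n ^ n := pow_pos (hR0 n) n
      have h4 : (0 : ℝ) < R n ^ m := pow_pos (hR0 n) m
      have h5 : (0 : ℝ) < 2 ^ n := by positivity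
      rw [one_div, inv_pow, inv_mul_le_iff₀ h3, ← div_eq_mul_inv, le_div_iff₀ h5]
      calc R n ^ m * B n m * 2 ^ n = R n ^ m * (2 ^ n * B n m) := by ring
        _ ≤ R n ^ m * R n := by gcongr
        _ ≤ R n ^ n := h1
  refine ⟨fun t => ∑' n, f n t, contDiff_tsum (N := ⊤) hf (fun k _ => hv k)
    (fun k n t _ => hfv k n t), fun m => ?_⟩
  have hnear : ∀ n, f n =ᶠ[𝓝 0] fun t => t ^ n • a n := by
    intro n
    have h1 : Tendsto (fun t : ℝ => R n * t) (𝓝 0) (𝓝 0) := by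
      have : Continuous (fun t : ℝ => R n * t) := by fun_prop
      simpa using this.tendsto 0
    filter_upwards [h1.eventually ρ.eventuallyEq_one] with t ht
    have h3 : (R n ^ n) ≠ 0 := (pow_pos (hR0 n) n).ne'
    simp only [f, g]
    rw [ht, Pi.one_apply, one_smul, smul_smul, mul_pow, ← mul_assoc, inv_mul_cancel₀ h3, one_mul]
  have hval : ∀ n, iteratedDeriv m (f n) 0 = if m = n then (Nat.factorial m : ℝ) • a n else 0 :=
    fun n => ((hnear n).iteratedDeriv_eq m).trans (iteratedDeriv_pow_smul_zero (a n) m n)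
  -- The series may be differentiated termwise, and at 0 only the summand n = m has a nonzero
  -- derivative of order m.
  have hsum : iteratedFDeriv ℝ m (fun t => ∑' n, f n t) 0 = iteratedFDeriv ℝ m (f m) 0 := by
    rw [iteratedFDeriv_tsum_apply (N := ⊤) hf (fun k _ => hv k) (fun k n t _ => hfv k n t) le_top]
    refine tsum_eq_single m fun n hn => ?_
    rw [← norm_eq_zero, norm_iteratedFDeriv_eq_norm_iteratedDeriv, hval, if_neg hn.symm, norm_zero]
  rw [taylorCoeff, iteratedDeriv_eq_iteratedFDeriv, hsum, ← iteratedDeriv_eq_iteratedFDeriv, hval,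
    if_pos rfl, smul_smul, inv_mul_cancel₀ (by positivity), one_smul]

end Borel

/-! ## Calculus in Fréchet spaces -/

section FrechetCalculus

variable {G : Type v} [AddCommGroup G] [Module ℝ G] [TopologicalSpace G]

lemma FrechetCkOn.congr (n : ℕ) {F : Type u} [AddCommGroup F] [Module ℝ F] [TopologicalSpace F]
    [ContinuousAdd F] [ContinuousSMul ℝ F] {f g : F → G} {U : Set F} (hU : IsOpen U)
    (hf : FrechetCkOn n f U) (h : EqOn f g U) : FrechetCkOn n g U := by
  cases n with
  | zero => exact ContinuousOn.congr hf h.symm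
  | succ n =>
    obtain ⟨hc, f', hf', hn⟩ := hf
    refine ⟨hc.congr h.symm, f', fun x hx v => ?_, hn⟩
    -- As U is open, x + t v lies in U for small t, so the difference quotients of f and g at x
    -- agree eventually and the same f' serves both.
    have hlim : Tendsto (fun t : ℝ => x + t • v) (𝓝[≠] 0) (𝓝 x) := by
      have : Continuous fun t : ℝ => x + t • v := by fun_prop
      simpa using (this.tendsto 0).mono_left nhdsWithin_le_nhds
    refine (hf' x hx v).congr' ?_
    filter_upwards [hlim.eventually (hU.mem_nhds hx)] with t ht
    rw [h hx, h ht]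

/-- A map that is a smooth map between normed spaces composed with a continuous linear map is smooth
in the sense of calculus in Fréchet spaces. -/
lemma frechetCkOn_of_contDiffOn (n : ℕ) {H : Type v} [NormedAddCommGroup H] [NormedSpace ℝ H]
    {B : Type w} [NormedAddCommGroup B] [NormedSpace ℝ B] {g : B → H} {V : Set B} (hV : IsOpen V)
    (hg : ContDiffOn ℝ ∞ g V)
    {F : Type u} [AddCommGroup F] [Module ℝ F] [TopologicalSpace F] [ContinuousAdd F]
    [ContinuousSMul ℝ F] (L : F →L[ℝ] B) {f : F → H} {U : Set F} (hU : IsOpen U)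
    (hL : MapsTo L U V) (hf : EqOn f (g ∘ L) U) : FrechetCkOn n f U := by
  induction n generalizing B F with
  | zero => exact (hg.continuousOn.comp L.continuous.continuousOn hL).congr hf
  | succ n ih =>
    refine FrechetCkOn.congr (n + 1) hU (f := g ∘ L) ?_ hf.symm
    -- The directional derivative (x, v) ↦ dg(Lx)(Lv) is again a smooth map of normed spaces
    -- composed with a continuous linear map, namely L × L, so the induction varies the spaces as
    -- well.
    refine ⟨hg.continuousOn.comp L.continuous.continuousOn hL,
      fun p => fderiv ℝ g (L p.1) (L p.2), fun x hx v => ?_, ?_⟩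
    · have h1 : HasFDerivAt g (fderiv ℝ g (L x)) (L x) :=
        ((hg.differentiableOn (by simp)).differentiableAt (hV.mem_nhds (hL hx))).hasFDerivAt
      have h2 := (h1.hasLineDerivAt (L v)).tendsto_slope_zero
      simpa using h2
    · refine ih (B := B × B) (V := V ×ˢ univ) (g := fun q : B × B => fderiv ℝ g q.1 q.2)
        (hV.prod isOpen_univ) ?_ (L.prodMap L) (hU.prod isOpen_univ) ?_ fun _ _ => rfl
      · exact ((hg.fderiv_of_isOpen (m := ∞) hV (by simp)).comp contDiff_fst.contDiffOn
          fun q hq => hq.1).clm_apply contDiff_snd.contDiffOn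
      · exact fun q hq => ⟨hL hq.1, trivial⟩

lemma FrechetCkOn.prodMk (n : ℕ) {G' : Type v} [AddCommGroup G'] [Module ℝ G']
    [TopologicalSpace G'] {F : Type u} [AddCommGroup F] [Module ℝ F] [TopologicalSpace F]
    {f : F → G} {g : F → G'} {U : Set F} (hf : FrechetCkOn n f U) (hg : FrechetCkOn n g U) :
    FrechetCkOn n (fun x => (f x, g x)) U := by
  induction n generalizing F with
  | zero => exact ContinuousOn.prodMk hf hg
  | succ n ih =>
    obtain ⟨hc, f', hf', hn⟩ := hf
    obtain ⟨hc2, g', hg', hn2⟩ := hg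
    exact ⟨hc.prodMk hc2, fun p => (f' p, g' p), fun x hx v => (hf' x hx v).prodMk_nhds (hg' x hx v),
      ih hn hn2⟩

/-- A map into a closed subspace of a product is smooth if its components are. -/
lemma frechetCkOn_of_components (n : ℕ) {ι : Type*} {H : ι → Type w} [∀ i, NormedAddCommGroup (H i)]
    [∀ i, NormedSpace ℝ (H i)] {S : Submodule ℝ (∀ i, H i)} (hS : IsClosed (S : Set (∀ i, H i)))
    {F : Type u} [AddCommGroup F] [Module ℝ F] [TopologicalSpace F] [ContinuousAdd F]
    [ContinuousSMul ℝ F] {f : F → S} {U : Set F} (hU : IsOpen U)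
    (hf : ∀ i, FrechetCkOn n (fun x => (f x).1 i) U) : FrechetCkOn n f U := by
  induction n generalizing F with
  | zero =>
    rw [FrechetCkOn, continuousOn_iff_continuous_domRestrict]
    refine Continuous.subtype_mk (continuous_pi fun i => ?_) _
    exact continuousOn_iff_continuous_domRestrict.1 (hf i)
  | succ n ih =>
    have hc : ContinuousOn f U := by
      rw [continuousOn_iff_continuous_domRestrict]
      refine Continuous.subtype_mk (continuous_pi fun i => ?_) _
      exact continuousOn_iff_continuous_domRestrict.1 (hf i).1
    choose f' hf' hn using fun i => (hf i).2
    have hlim : ∀ x ∈ U, ∀ v : F, Tendsto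
        (fun t : ℝ => (((t⁻¹ • (f (x + t • v) - f x) : S)) : ∀ i, H i)) (𝓝[≠] 0)
        (𝓝 fun i => f' i (x, v)) := fun x hx v => tendsto_pi_nhds.2 fun i => hf' i x hx v
    -- The difference quotients lie in S, so closedness is needed for the componentwise limit to
    -- define a derivative with values in S.
    have hmem : ∀ x ∈ U, ∀ v : F, (fun i => f' i (x, v)) ∈ S := fun x hx v =>
      hS.mem_of_tendsto (hlim x hx v) (Eventually.of_forall fun t => Subtype.coe_prop _)
    classical
    let D : F × F → S := fun p =>
      if h : p.1 ∈ U then ⟨fun i => f' i p, hmem p.1 h p.2⟩ else 0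
    have hD : ∀ i, EqOn (f' i) (fun p => (D p).1 i) (U ×ˢ univ) := by
      intro i p hp
      simp only [D, dif_pos hp.1]
    refine ⟨hc, D, fun x hx v => ?_, ih (hU.prod isOpen_univ) fun i =>
      FrechetCkOn.congr n (hU.prod isOpen_univ) (hn i) (hD i)⟩
    have h1 : (D (x, v)).1 = fun i => f' i (x, v) := by
      funext i
      exact (hD i (show (x, v) ∈ U ×ˢ univ from ⟨hx, trivial⟩)).symm
    rw [tendsto_subtype_rng, h1]
    exact hlim x hx v

end FrechetCalculus

/-! ## The limit spaces are Fréchet spaces -/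

section LimitSpaces

/-- Countability of the index set gives metrizability of the product; completeness passes to closed
subspaces and the remaining properties to all subspaces. -/
lemma isFrechetSpace_of_isClosed {ι : Type w} [Countable ι] {H : ι → Type u}
    [∀ i, NormedAddCommGroup (H i)] [∀ i, NormedSpace ℝ (H i)] [∀ i, CompleteSpace (H i)]
    {S : Submodule ℝ (∀ i, H i)} (hS : IsClosed (S : Set (∀ i, H i))) : IsFrechetSpace S where
  isUniformAddGroup := AddSubgroup.isUniformAddGroup S.toAddSubgroup
  continuousSMul := inferInstance
  locallyConvex := inferInstance
  metrizable :=
    have : TopologicalSpace.MetrizableSpace (∀ i, H i) := UniformSpace.metrizableSpace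
    Topology.IsEmbedding.subtypeVal.metrizableSpace
  complete := hS.completeSpace_coe

variable {E : Type u} [NormedAddCommGroup E] [NormedSpace ℝ E]

lemma isClosed_powerLim (d : ℕ) : IsClosed (PowerLim E d : Set (∀ i : ℕ, Fin (i + d) → E)) := by
  have h : (PowerLim E d : Set (∀ i : ℕ, Fin (i + d) → E)) = ⋂ (i : ℕ) (j : ℕ) (h : i ≤ j),
      {ξ | truncate E (Nat.add_le_add_right h d) (ξ j) = ξ i} := by
    ext ξ
    simp only [mem_iInter]
    rfl
  rw [h]
  exact isClosed_iInter fun i => isClosed_iInter fun j => isClosed_iInter fun h =>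
    isClosed_eq ((truncate E _).continuous.comp (continuous_apply j)) (continuous_apply i)

lemma isClosed_endLim : IsClosed (EndLim E :
    Set (∀ i : ℕ, ∀ j : Fin (i + 1), (Fin (j : ℕ) → E) →L[ℝ] (Fin (j : ℕ) → E))) := by
  have h : (EndLim E :
      Set (∀ i : ℕ, ∀ j : Fin (i + 1), (Fin (j : ℕ) → E) →L[ℝ] (Fin (j : ℕ) → E))) =
      (⋂ (i : ℕ) (a : Fin (i + 1)) (b : Fin (i + 1)) (h : a ≤ b) (ξ : Fin (b : ℕ) → E),
        {t | truncate E h (t i b ξ) = t i a (truncate E h ξ)}) ∩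
      ⋂ (i : ℕ) (j : ℕ) (h : i ≤ j) (a : Fin (i + 1)),
        {t | t j (Fin.castLE (Nat.succ_le_succ h) a) = t i a} := by
    ext t
    simp only [mem_inter_iff, mem_iInter]
    rfl
  rw [h]
  refine IsClosed.inter ?_ ?_
  · refine isClosed_iInter fun i => isClosed_iInter fun a => isClosed_iInter fun b =>
      isClosed_iInter fun h => isClosed_iInter fun ξ => isClosed_eq ?_ ?_
    · exact (truncate E _).continuous.comp
        ((ContinuousLinearMap.apply ℝ (Fin (b : ℕ) → E) ξ).continuous.comp
          ((continuous_apply b).comp (continuous_apply i)))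
    · exact (ContinuousLinearMap.apply ℝ (Fin (a : ℕ) → E) _).continuous.comp
          ((continuous_apply a).comp (continuous_apply i))
  · exact isClosed_iInter fun i => isClosed_iInter fun j => isClosed_iInter fun h =>
      isClosed_iInter fun a => isClosed_eq ((continuous_apply _).comp (continuous_apply j))
        ((continuous_apply a).comp (continuous_apply i))

/-- The projection `lim E^(i+d) → E^(k+d)`. -/
noncomputable def PowerLim.proj (E : Type u) [NormedAddCommGroup E] [NormedSpace ℝ E] (d k : ℕ) :
    PowerLim E d →L[ℝ] (Fin (k + d) → E) :=
  (ContinuousLinearMap.proj (R := ℝ) (φ := fun i : ℕ => Fin (i + d) → E) k).comp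
    (PowerLim E d).subtypeL

lemma PowerLim.proj_apply (d k : ℕ) (ξ : PowerLim E d) : PowerLim.proj E d k ξ = ξ.1 k := rfl

lemma PowerLim.apply_eq {d : ℕ} (ξ : PowerLim E d) {i j : ℕ} (h : i ≤ j) (a : Fin (i + d)) :
    ξ.1 i a = ξ.1 j (Fin.castLE (Nat.add_le_add_right h d) a) :=
  (congrFun (ξ.2 i j h) a).symm

/-- The base coordinate is the same at all levels, so the domain of a limit chart is cut out at
level 0. -/
lemma powerLim_apply_zero (ξ : PowerLim E 1) (k : ℕ) : ξ.1 k 0 = ξ.1 0 0 :=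
  (PowerLim.apply_eq ξ (Nat.zero_le k) 0).symm

/-- A map into `lim E^(i+d)` is smooth if its components are given by smooth maps between normed
spaces, composed with continuous linear maps. -/
lemma frechetCkOn_powerLim (n : ℕ) {d : ℕ} {F : Type u} [AddCommGroup F] [Module ℝ F]
    [TopologicalSpace F] [ContinuousAdd F] [ContinuousSMul ℝ F] {f : F → PowerLim E d} {U : Set F}
    (hU : IsOpen U) {B : ℕ → Type u} [∀ k, NormedAddCommGroup (B k)] [∀ k, NormedSpace ℝ (B k)]
    {V : ∀ k, Set (B k)} (hV : ∀ k, IsOpen (V k)) {g : ∀ k, B k → Fin (k + d) → E}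
    (hg : ∀ k, ContDiffOn ℝ ∞ (g k) (V k)) (L : ∀ k, F →L[ℝ] B k)
    (hL : ∀ k, MapsTo (L k) U (V k)) (hf : ∀ x ∈ U, ∀ k, (f x).1 k = g k (L k x)) :
    FrechetCkOn n f U := by
  have h : ∀ k, FrechetCkOn n (fun x => (f x).1 k) U := fun k =>
    frechetCkOn_of_contDiffOn n (hV k) (hg k) (L k) hU (hL k) fun x hx => hf x hx k
  exact frechetCkOn_of_components (H := fun k : ℕ => Fin (k + d) → E) n (isClosed_powerLim d) hU h

end LimitSpaces

/-! ## Curves in charts -/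

section Charts

variable {E : Type u} [NormedAddCommGroup E] [NormedSpace ℝ E]
  {M : Type v} [TopologicalSpace M] [ChartedSpace E M]

/-- The domain of the change of charts `e' ∘ e⁻¹`. -/
def SmoothChart.overlap (e e' : SmoothChart E M) : Set E := (e.1.symm ≫ₕ e'.1).source

lemma SmoothChart.mem_overlap {e e' : SmoothChart E M} {y : E} :
    y ∈ e.overlap e' ↔ y ∈ e.1.target ∧ e.1.symm y ∈ e'.1.source := by
  simp [SmoothChart.overlap]

lemma SmoothChart.isOpen_overlap (e e' : SmoothChart E M) : IsOpen (e.overlap e') :=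
  (e.1.symm ≫ₕ e'.1).open_source

lemma SmoothChart.apply_mem_overlap {e e' : SmoothChart E M} {x : M} (hx : x ∈ e.1.source)
    (hx' : x ∈ e'.1.source) : e.1 x ∈ e.overlap e' :=
  SmoothChart.mem_overlap.2 ⟨e.1.map_source hx, by rwa [e.1.left_inv hx]⟩

lemma SmoothChart.mapsTo_overlap (e e' : SmoothChart E M) :
    MapsTo (e'.1 ∘ e.1.symm) (e.overlap e') e'.1.target := fun _ hy =>
  e'.1.map_source (SmoothChart.mem_overlap.1 hy).2

/-- The extension `(x, z_1, …, z_k) ↦ (φ(x), dφ(x) z_1, …, dφ(x) z_k)` of the map `φ`. -/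
noncomputable def diagExtend (φ : E → E) (k : ℕ) (z : Fin (k + 1) → E) : Fin (k + 1) → E :=
  Fin.cons (φ (z 0)) fun i => fderiv ℝ φ (z 0) (z i.succ)

lemma diagExtend_zero (φ : E → E) (k : ℕ) (z : Fin (k + 1) → E) : diagExtend φ k z 0 = φ (z 0) := by
  simp [diagExtend]

lemma contDiffOn_diagExtend {U : Set E} (hU : IsOpen U) {φ : E → E} (hφ : ContDiffOn ℝ ∞ φ U)
    (k : ℕ) : ContDiffOn ℝ ∞ (diagExtend φ k) {z | z 0 ∈ U} := by
  refine contDiffOn_pi.2 fun i => Fin.cases ?_ (fun i => ?_) i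
  · simp only [diagExtend, Fin.cons_zero]
    exact hφ.comp (contDiff_apply ℝ E _).contDiffOn fun z hz => hz
  · simp only [diagExtend, Fin.cons_succ]
    exact ((hφ.fderiv_of_isOpen (m := ∞) hU (by simp)).comp
      (contDiff_apply ℝ E (0 : Fin (k + 1))).contDiffOn fun z hz => hz).clm_apply
        (contDiff_apply ℝ E _).contDiffOn

lemma SmoothChart.contDiffOn (e e' : SmoothChart E M) :
    ContDiffOn ℝ ∞ (e'.1 ∘ e.1.symm) (e.overlap e') := by
  rw [← contMDiffOn_iff_contDiffOn]
  refine (contMDiffOn_of_mem_maximalAtlas e'.2).comp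
    ((contMDiffOn_symm_of_mem_maximalAtlas e.2).mono fun y hy => ?_) fun y hy => ?_
  · exact (SmoothChart.mem_overlap.1 hy).1
  · exact (SmoothChart.mem_overlap.1 hy).2

/-- The covariance argument differentiates in time, so the change of charts must be available along
the curve on an open set of times, not only at 0. -/
lemma CurveAt.exists_isOpen {x : M} (γ : CurveAt E x) {e e' : SmoothChart E M}
    (hx : x ∈ e.1.source) (hx' : x ∈ e'.1.source) :
    ∃ I : Set ℝ, IsOpen I ∧ (0 : ℝ) ∈ I ∧ ContDiffOn ℝ ∞ (e.1 ∘ γ.toFun) I ∧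
      MapsTo (e.1 ∘ γ.toFun) I (e.overlap e') ∧
      EqOn (e'.1 ∘ γ.toFun) ((e'.1 ∘ e.1.symm) ∘ (e.1 ∘ γ.toFun)) I := by
  obtain ⟨ε, hε, hγ⟩ := γ.smooth
  have hI := hγ.continuousOn.isOpen_inter_preimage isOpen_Ioo
    (e.1.open_source.inter e'.1.open_source)
  refine ⟨_, hI, ⟨⟨by simpa using hε, hε⟩, ?_⟩, ?_, fun t ht => ?_, fun t ht => ?_⟩
  · rw [mem_preimage, γ.map_zero]
    exact ⟨hx, hx'⟩
  · rw [← contMDiffOn_iff_contDiffOn]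
    exact (contMDiffOn_of_mem_maximalAtlas e.2).comp (hγ.mono inter_subset_left)
      fun t ht => ht.2.1
  · exact SmoothChart.apply_mem_overlap ht.2.1 ht.2.2
  · simp only [Function.comp_apply]
    rw [e.1.left_inv ht.2.1]

lemma curveJet_congr {c c' : ℝ → E} {t : ℝ} (h : c =ᶠ[𝓝 t] c') (k : ℕ) :
    curveJet c k t = curveJet c' k t := by
  funext j
  simp only [curveJet, taylorCoeff, h.iteratedDeriv_eq]

/-- The curve `e⁻¹ ∘ c` in `M`. -/
def SmoothChart.curve (e : SmoothChart E M) (c : ℝ → E) (hc : ContDiff ℝ ∞ c)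
    (h0 : c 0 ∈ e.1.target) : CurveAt E (e.1.symm (c 0)) where
  toFun := e.1.symm ∘ c
  map_zero := rfl
  smooth := by
    obtain ⟨ε, hε, h⟩ := Metric.isOpen_iff.1 (e.1.open_target.preimage hc.continuous) 0 h0
    refine ⟨ε, hε, (contMDiffOn_symm_of_mem_maximalAtlas e.2).comp hc.contMDiff.contMDiffOn ?_⟩
    intro t ht
    exact h (by simpa [Real.ball_eq_Ioo] using ht)

lemma SmoothChart.curveJet_curve (e : SmoothChart E M) (c : ℝ → E) (hc : ContDiff ℝ ∞ c)
    (h0 : c 0 ∈ e.1.target) (k : ℕ) :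
    curveJet (e.1 ∘ (e.curve c hc h0).toFun) k 0 = curveJet c k 0 := by
  refine curveJet_congr ?_ k
  filter_upwards [(e.1.open_target.preimage hc.continuous).mem_nhds h0] with t ht
  exact e.1.right_inv ht

/-- The constant curve. -/
def CurveAt.const (E : Type u) [NormedAddCommGroup E] [NormedSpace ℝ E] {M : Type v}
    [TopologicalSpace M] [ChartedSpace E M] (x : M) : CurveAt E x where
  toFun _ := x
  map_zero := rfl
  smooth := ⟨1, one_pos, contMDiffOn_const⟩

/-- The chart `e` of `M` around `x`. -/
def smoothChartAt (E : Type u) [NormedAddCommGroup E] [NormedSpace ℝ E] {M : Type v}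
    [TopologicalSpace M] [ChartedSpace E M] [IsManifold 𝓘(ℝ, E) ∞ M] (x : M) : SmoothChart E M :=
  ⟨chartAt E x, IsManifold.chart_mem_maximalAtlas x⟩

lemma mem_smoothChartAt_source [IsManifold 𝓘(ℝ, E) ∞ M] (x : M) :
    x ∈ (smoothChartAt E x).1.source := mem_chart_source E x

/-! ## The jet charts -/

/-- The class `[γ, x]_∞`. -/
def InfTangent.ofCurve {x : M} (γ : CurveAt E x) : InfTangent E M :=
  ⟨x, Quotient.mk (curveSetoidInf E x) γ⟩

lemma jetChart_ofCurve {e : SmoothChart E M} {x : M} (hx : x ∈ e.1.source) (γ : CurveAt E x)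
    (k : ℕ) : jetChart e k ((InfTangent.ofCurve γ).toOrder k) = curveJet (e.1 ∘ γ.toFun) k 0 :=
  dif_pos hx

lemma HigherTangent.exists_ofCurve {k : ℕ} (p : HigherTangent E M k) :
    ∃ γ : CurveAt E p.base, p = (InfTangent.ofCurve γ).toOrder k := by
  obtain ⟨x, q⟩ := p
  induction q using Quotient.inductionOn with
  | h γ => exact ⟨γ, rfl⟩

lemma jetChart_zero {e : SmoothChart E M} {k : ℕ} {p : HigherTangent E M k}
    (hp : p.base ∈ e.1.source) : jetChart e k p 0 = e.1 p.base := by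
  obtain ⟨γ, h⟩ := p.exists_ofCurve
  rw [h, jetChart_ofCurve hp, curveJet_zero, Function.comp_apply, γ.map_zero]
  rfl

lemma jetChart_restrict (e : SmoothChart E M) {i j : ℕ} (h : i ≤ j) (p : HigherTangent E M j) :
    jetChart e i (p.restrict h) = truncate E (Nat.add_le_add_right h 1) (jetChart e j p) := by
  obtain ⟨x, q⟩ := p
  induction q using Quotient.inductionOn with
  | h γ =>
    by_cases hx : x ∈ e.1.source
    · exact (jetChart_ofCurve hx γ i).trans
        (congrArg (truncate E (Nat.add_le_add_right h 1)) (jetChart_ofCurve hx γ j)).symm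
    -- Outside the domain of e both sides take the default value 0, so no hypothesis on the base
    -- point is needed.
    · have h1 : jetChart e j ⟨x, Quotient.mk (curveSetoid E j x) γ⟩ = 0 := dif_neg hx
      rw [h1, map_zero]
      exact dif_neg hx

lemma LinearConnection.chart_restrict (C : LinearConnection E M) (e : SmoothChart E M) {i j : ℕ}
    (h : i ≤ j) (p : HigherTangent E M j) :
    C.chart e i (p.restrict h) = truncate E (Nat.add_le_add_right h 1) (C.chart e j p) := by
  rw [LinearConnection.chart, LinearConnection.chart, jetChart_restrict, zMap_truncate _ h]

lemma LinearConnection.chart_zero (C : LinearConnection E M) {e : SmoothChart E M} {k : ℕ}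
    {p : HigherTangent E M k} (hp : p.base ∈ e.1.source) : C.chart e k p 0 = e.1 p.base := by
  rw [LinearConnection.chart, zMap_zero, jetChart_zero hp]

lemma LinearConnection.compatible_overlap (C : LinearConnection E M) (e e' : SmoothChart E M) :
    ∀ y ∈ e.overlap e', ∀ ξ η : E, fderiv ℝ (e'.1 ∘ e.1.symm) y (C.Γ e y ξ η) =
      fderiv ℝ (fderiv ℝ (e'.1 ∘ e.1.symm)) y ξ η +
        C.Γ e' ((e'.1 ∘ e.1.symm) y) (fderiv ℝ (e'.1 ∘ e.1.symm) y ξ)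
          (fderiv ℝ (e'.1 ∘ e.1.symm) y η) := by
  intro y hy ξ η
  obtain ⟨h1, h2⟩ := SmoothChart.mem_overlap.1 hy
  have := C.compatible e e' (e.1.symm y) (e.1.map_target h1) h2 ξ η
  rwa [e.1.right_inv h1] at this

lemma LinearConnection.zMap_curveJet (C : LinearConnection E M) {e e' : SmoothChart E M} {x : M}
    (hx : x ∈ e.1.source) (hx' : x ∈ e'.1.source) (γ : CurveAt E x) (k : ℕ) :
    zMap (C.Γ e') k (curveJet (e'.1 ∘ γ.toFun) k 0) =
      diagExtend (e'.1 ∘ e.1.symm) k (zMap (C.Γ e) k (curveJet (e.1 ∘ γ.toFun) k 0)) := by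
  obtain ⟨I, hI, h0, hc, hm, heq⟩ := γ.exists_isOpen hx hx'
  rw [curveJet_congr (eventually_of_mem (hI.mem_nhds h0) heq),
    zMap_curveJet_comp (e.isOpen_overlap e') e'.1.open_target
      ((C.smooth e).mono fun y hy => (SmoothChart.mem_overlap.1 hy).1) (C.smooth e')
      (e.contDiffOn e') (e.mapsTo_overlap e') (C.compatible_overlap e e') hI hc hm k h0,
    diagExtend, zMap_zero, curveJet_zero]

/-- The change of charts of `T^k M`: it is diagonal in the fibres. -/
lemma LinearConnection.chart_eq (C : LinearConnection E M) {e e' : SmoothChart E M} {k : ℕ}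
    {p : HigherTangent E M k} (hp : p.base ∈ e.1.source) (hp' : p.base ∈ e'.1.source) :
    C.chart e' k p = diagExtend (e'.1 ∘ e.1.symm) k (C.chart e k p) := by
  obtain ⟨γ, h⟩ := p.exists_ofCurve
  rw [h, LinearConnection.chart, LinearConnection.chart, jetChart_ofCurve hp, jetChart_ofCurve hp',
    C.zMap_curveJet hp hp']

/-- Agreement of jets in one chart implies agreement in every other. Instead of the higher chain
rule, the connection is used: the z-coordinates in e' are determined by those in e, and `zMap` is
injective. -/
lemma curveEquiv_of_curveJet_eq (C : LinearConnection E M) {e : SmoothChart E M} {x : M}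
    (hx : x ∈ e.1.source) {γ₁ γ₂ : CurveAt E x} {k : ℕ}
    (h : curveJet (e.1 ∘ γ₁.toFun) k 0 = curveJet (e.1 ∘ γ₂.toFun) k 0) :
    CurveAt.Equiv k γ₁ γ₂ := by
  intro e' hx' j _ hj
  have h1 : curveJet (e'.1 ∘ γ₁.toFun) k 0 = curveJet (e'.1 ∘ γ₂.toFun) k 0 := by
    rw [← zInv_zMap (C.Γ e') k (curveJet (e'.1 ∘ γ₁.toFun) k 0), C.zMap_curveJet hx hx', h,
      ← C.zMap_curveJet hx hx', zInv_zMap]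
  have h2 := congrFun h1 ⟨j, Nat.lt_succ_of_le hj⟩
  exact smul_right_injective E (inv_ne_zero (Nat.cast_ne_zero.2 (Nat.factorial_ne_zero j))) h2

lemma jetChart_injOn (C : LinearConnection E M) {e : SmoothChart E M} {k : ℕ}
    {p q : HigherTangent E M k} (hp : p.base ∈ e.1.source) (hq : q.base ∈ e.1.source)
    (h : jetChart e k p = jetChart e k q) : p = q := by
  have hb : p.base = q.base := by
    apply e.1.injOn hp hq
    rw [← jetChart_zero hp, h, jetChart_zero hq]
  obtain ⟨x, p⟩ := p
  obtain ⟨y, q⟩ := q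
  obtain rfl : x = y := hb
  induction p using Quotient.inductionOn with
  | h γ₁ =>
    induction q using Quotient.inductionOn with
    | h γ₂ =>
      congr 1
      refine Quotient.sound (s := curveSetoid E k x) (curveEquiv_of_curveJet_eq C hp ?_)
      exact (jetChart_ofCurve hp γ₁ k).symm.trans (h.trans (jetChart_ofCurve hp γ₂ k))

variable [CompleteSpace E]

open Classical in
/-- The point of `T^∞ M` over the domain of `e` whose Taylor coefficients in the chart `e` form the
sequence `a`. -/
noncomputable def SmoothChart.pointOfCoeffs (e : SmoothChart E M) (a : ℕ → E) : InfTangent E M :=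
  if h : a 0 ∈ e.1.target then
    InfTangent.ofCurve (e.curve (exists_contDiff_taylorCoeff_eq a).choose
      (exists_contDiff_taylorCoeff_eq a).choose_spec.1 (by
        rw [← taylorCoeff_zero (exists_contDiff_taylorCoeff_eq a).choose,
          (exists_contDiff_taylorCoeff_eq a).choose_spec.2]
        exact h))
  -- The default is a constant curve at e⁻¹(a_0), so that the base point is e⁻¹(a_0) for every
  -- sequence a.
  else InfTangent.ofCurve (CurveAt.const E (e.1.symm (a 0)))

lemma SmoothChart.pointOfCoeffs_base (e : SmoothChart E M) (a : ℕ → E) :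
    (e.pointOfCoeffs a).base = e.1.symm (a 0) := by
  unfold SmoothChart.pointOfCoeffs
  split_ifs with h
  · rw [← (exists_contDiff_taylorCoeff_eq a).choose_spec.2 0, taylorCoeff_zero]
    rfl
  · rfl

lemma SmoothChart.jetChart_pointOfCoeffs (e : SmoothChart E M) (a : ℕ → E)
    (h : a 0 ∈ e.1.target) (k : ℕ) :
    jetChart e k ((e.pointOfCoeffs a).toOrder k) = fun j : Fin (k + 1) => a j := by
  unfold SmoothChart.pointOfCoeffs
  rw [dif_pos h, jetChart_ofCurve, SmoothChart.curveJet_curve]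
  · funext j
    exact (exists_contDiff_taylorCoeff_eq a).choose_spec.2 j
  · apply e.1.map_target
    rwa [← taylorCoeff_zero (exists_contDiff_taylorCoeff_eq a).choose,
          (exists_contDiff_taylorCoeff_eq a).choose_spec.2]

/-- The inverse of `jetChart`. -/
noncomputable def jetInv (e : SmoothChart E M) (k : ℕ) (u : Fin (k + 1) → E) :
    HigherTangent E M k :=
  -- Padding the jet with zeros reduces finite order to the case of full sequences.
  (e.pointOfCoeffs fun j => if h : j < k + 1 then u ⟨j, h⟩ else 0).toOrder k

lemma jetInv_base (e : SmoothChart E M) (k : ℕ) (u : Fin (k + 1) → E) :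
    (jetInv e k u).base = e.1.symm (u 0) := by
  change (e.pointOfCoeffs _).base = _
  rw [e.pointOfCoeffs_base, dif_pos (Nat.succ_pos k)]
  rfl

lemma jetChart_jetInv (e : SmoothChart E M) (k : ℕ) {u : Fin (k + 1) → E} (h : u 0 ∈ e.1.target) :
    jetChart e k (jetInv e k u) = u := by
  rw [jetInv, e.jetChart_pointOfCoeffs]
  · funext j
    rw [dif_pos j.2]
  · rw [dif_pos (Nat.succ_pos k)]
    exact h

lemma jetInv_jetChart (C : LinearConnection E M) {e : SmoothChart E M} {k : ℕ}
    {p : HigherTangent E M k} (hp : p.base ∈ e.1.source) : jetInv e k (jetChart e k p) = p := by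
  have h0 : jetChart e k p 0 ∈ e.1.target := by
    rw [jetChart_zero hp]
    exact e.1.map_source hp
  refine jetChart_injOn C (e := e) ?_ hp (jetChart_jetInv e k h0)
  rw [jetInv_base]
  exact e.1.map_target h0

/-- The map `Ψ_e^k` as a homeomorphism onto its image. -/
noncomputable def LinearConnection.jetHomeo (C : LinearConnection E M) (e : SmoothChart E M)
    (k : ℕ) : OpenPartialHomeomorph (HigherTangent E M k) (Fin (k + 1) → E) where
  toFun := jetChart e k
  invFun := jetInv e k
  source := {p | p.base ∈ e.1.source}
  target := {u | u 0 ∈ e.1.target}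
  map_source' p hp := by
    rw [mem_ofPred_eq, jetChart_zero hp]
    exact e.1.map_source hp
  map_target' u hu := by
    rw [mem_ofPred_eq, jetInv_base]
    exact e.1.map_target hu
  left_inv' _ hp := jetInv_jetChart C hp
  right_inv' _ hu := jetChart_jetInv e k hu
  open_source := TopologicalSpace.isOpen_generateFrom_of_mem ⟨e, univ, isOpen_univ, by simp⟩
  open_target := isOpen_base_preimage e.1.open_target k
  continuousOn_toFun := by
    have hs : IsOpen {p : HigherTangent E M k | p.base ∈ e.1.source} :=
      TopologicalSpace.isOpen_generateFrom_of_mem ⟨e, univ, isOpen_univ, by simp⟩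
    refine (continuousOn_open_iff hs).2 fun V hV => ?_
    exact TopologicalSpace.isOpen_generateFrom_of_mem ⟨e, V, hV, rfl⟩
  continuousOn_invFun := by
    rw [continuousOn_to_generateFrom_iff]
    rintro u hu _ ⟨e', V, hV, rfl⟩ ⟨hb, hjV⟩
    have hW := isOpen_base_preimage (e.isOpen_overlap e') k
    have huW : u ∈ {u : Fin (k + 1) → E | u 0 ∈ e.overlap e'} :=
      SmoothChart.mem_overlap.2 ⟨hu, by rwa [jetInv_base] at hb⟩
    -- The topology is generated by all charts e', so continuity of the inverse needs the change of
    -- jet coordinates from e to e'. It is the diagonal change of z-coordinates conjugated by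
    -- `zMap`, and hence continuous.
    have hT : ContinuousOn (fun u => zInv (C.Γ e') k
        (diagExtend (e'.1 ∘ e.1.symm) k (zMap (C.Γ e) k u)))
        {u : Fin (k + 1) → E | u 0 ∈ e.overlap e'} := by
      refine (contDiffOn_zInv e'.1.open_target (C.smooth e') k).continuousOn.comp
        ((contDiffOn_diagExtend (e.isOpen_overlap e') (e.contDiffOn e') k).continuousOn.comp
          ((contDiffOn_zMap e.1.open_target (C.smooth e) k).continuousOn.mono ?_) ?_) ?_
      · exact fun y hy => (SmoothChart.mem_overlap.1 hy).1
      · intro y hy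
        rwa [mem_ofPred_eq, zMap_zero]
      · intro y hy
        change diagExtend (e'.1 ∘ e.1.symm) k (zMap (C.Γ e) k y) 0 ∈ e'.1.target
        rw [diagExtend_zero, zMap_zero]
        exact e.mapsTo_overlap e' hy
    have hb' : ∀ y : Fin (k + 1) → E, y 0 ∈ e.overlap e' →
        (jetInv e k y).base ∈ e.1.source ∧ (jetInv e k y).base ∈ e'.1.source := by
      intro y hy
      rw [jetInv_base]
      exact ⟨e.1.map_target (SmoothChart.mem_overlap.1 hy).1, (SmoothChart.mem_overlap.1 hy).2⟩
    have hTeq : ∀ y : Fin (k + 1) → E, y 0 ∈ e.overlap e' →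
        jetChart e' k (jetInv e k y) = zInv (C.Γ e') k
          (diagExtend (e'.1 ∘ e.1.symm) k (zMap (C.Γ e) k y)) := by
      intro y hy
      rw [← zInv_zMap (C.Γ e') k (jetChart e' k (jetInv e k y))]
      congr 1
      refine (C.chart_eq (hb' y hy).1 (hb' y hy).2).trans ?_
      rw [LinearConnection.chart, jetChart_jetInv e k (SmoothChart.mem_overlap.1 hy).1]
    refine mem_nhdsWithin_of_mem_nhds (mem_of_superset
      ((hT.isOpen_inter_preimage hW hV).mem_nhds ⟨huW, ?_⟩) ?_)
    · rwa [mem_preimage, ← hTeq u huW]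
    · rintro y ⟨hy, hyV⟩
      refine ⟨(hb' y hy).2, ?_⟩
      rwa [hTeq y hy]

/-- The map `Φ_e^k` as a homeomorphism onto its image. -/
noncomputable def LinearConnection.chartHomeo (C : LinearConnection E M) (e : SmoothChart E M)
    (k : ℕ) : OpenPartialHomeomorph (HigherTangent E M k) (Fin (k + 1) → E) :=
  (C.jetHomeo e k).trans' (zHomeo e.1.open_target (C.smooth e) k) rfl

lemma LinearConnection.chartHomeo_apply (C : LinearConnection E M) (e : SmoothChart E M)
    (k : ℕ) (p : HigherTangent E M k) : C.chartHomeo e k p = C.chart e k p := rfl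

lemma LinearConnection.chartHomeo_source (C : LinearConnection E M) (e : SmoothChart E M)
    (k : ℕ) : (C.chartHomeo e k).source = {p | p.base ∈ e.1.source} := rfl

lemma LinearConnection.chartHomeo_target (C : LinearConnection E M) (e : SmoothChart E M)
    (k : ℕ) : (C.chartHomeo e k).target = {u | u 0 ∈ e.1.target} := rfl

lemma LinearConnection.chartHomeo_symm_base (C : LinearConnection E M) (e : SmoothChart E M)
    (k : ℕ) (u : Fin (k + 1) → E) : ((C.chartHomeo e k).symm u).base = e.1.symm (u 0) := by
  change (jetInv e k (zInv (C.Γ e) k u)).base = _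
  rw [jetInv_base, zInv_zero]

/-! ### The smooth structure of T^k M and the connecting maps. -/

variable [IsManifold 𝓘(ℝ, E) ∞ M]

/-- The manifold structure of `T^k M`, given by the charts `Φ_e^k`. -/
@[reducible] noncomputable def LinearConnection.chartedSpace (C : LinearConnection E M) (k : ℕ) :
    ChartedSpace (Fin (k + 1) → E) (HigherTangent E M k) where
  atlas := range fun e => C.chartHomeo e k
  chartAt p := C.chartHomeo (smoothChartAt E p.base) k
  mem_chart_source p := mem_smoothChartAt_source p.base
  chart_mem_atlas p := ⟨smoothChartAt E p.base, rfl⟩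

lemma LinearConnection.isManifold (C : LinearConnection E M) (k : ℕ) :
    letI := C.chartedSpace k
    IsManifold 𝓘(ℝ, Fin (k + 1) → E) ∞ (HigherTangent E M k) := by
  let _ := C.chartedSpace k
  refine isManifold_of_contDiffOn _ _ _ ?_
  rintro _ _ ⟨e, rfl⟩ ⟨e', rfl⟩
  simp only [modelWithCornersSelf_coe, modelWithCornersSelf_coe_symm, Function.comp_id,
    Function.id_comp, preimage_id, range_id, inter_univ]
  have hsub : ∀ u ∈ ((C.chartHomeo e k).symm ≫ₕ C.chartHomeo e' k).source,
      u 0 ∈ e.1.target ∧ e.1.symm (u 0) ∈ e'.1.source := by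
    intro u hu
    rw [OpenPartialHomeomorph.trans_source] at hu
    have h2 := hu.2
    rw [mem_preimage, chartHomeo_source, mem_ofPred_eq, chartHomeo_symm_base] at h2
    exact ⟨hu.1, h2⟩
  refine ((contDiffOn_diagExtend (e.isOpen_overlap e') (e.contDiffOn e') k).mono
    fun u hu => SmoothChart.mem_overlap.2 (hsub u hu)).congr fun u hu => ?_
  obtain ⟨h1, h2⟩ := hsub u hu
  have h3 : (C.chartHomeo e k) ((C.chartHomeo e k).symm u) = u := (C.chartHomeo e k).right_inv h1
  refine (C.chart_eq (e := e) (p := (C.chartHomeo e k).symm u) ?_ ?_).trans ?_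
  · rw [chartHomeo_symm_base]
    exact e.1.map_target h1
  · rwa [chartHomeo_symm_base]
  · rw [chartHomeo_apply] at h3
    rw [h3]

lemma LinearConnection.chartHomeo_mem (C : LinearConnection E M) (e : SmoothChart E M) (k : ℕ) :
    letI := C.chartedSpace k
    C.chartHomeo e k ∈ IsManifold.maximalAtlas 𝓘(ℝ, Fin (k + 1) → E) ∞ (HigherTangent E M k) := by
  let _ := C.chartedSpace k
  have : IsManifold 𝓘(ℝ, Fin (k + 1) → E) ∞ (HigherTangent E M k) := C.isManifold k
  exact IsManifold.subset_maximalAtlas ⟨e, rfl⟩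

/-- Ψ is `zInv` after Φ, and both `zMap` and `zInv` are smooth. Hence the Φ define the same smooth
structure on T^k M as the Ψ, whatever the connection. -/
lemma LinearConnection.jetHomeo_mem (C : LinearConnection E M) (e : SmoothChart E M) (k : ℕ) :
    letI := C.chartedSpace k
    C.jetHomeo e k ∈ IsManifold.maximalAtlas 𝓘(ℝ, Fin (k + 1) → E) ∞ (HigherTangent E M k) := by
  let _ := C.chartedSpace k
  have : IsManifold 𝓘(ℝ, Fin (k + 1) → E) ∞ (HigherTangent E M k) := C.isManifold k
  have hmem := C.chartHomeo_mem e k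
  refine OpenPartialHomeomorph.mem_maximalAtlas_of_contMDiffOn (C.jetHomeo e k) ?_ ?_
  · have h1 : ContMDiffOn 𝓘(ℝ, Fin (k + 1) → E) 𝓘(ℝ, Fin (k + 1) → E) ∞ (zInv (C.Γ e) k)
        (C.chartHomeo e k).target := (contDiffOn_zInv e.1.open_target (C.smooth e) k).contMDiffOn
    refine (h1.comp (contMDiffOn_of_mem_maximalAtlas hmem)
      (C.chartHomeo e k).mapsTo).congr fun p hp => ?_
    exact (zInv_zMap (C.Γ e) k _).symm
  · have h1 : ContMDiffOn 𝓘(ℝ, Fin (k + 1) → E) 𝓘(ℝ, Fin (k + 1) → E) ∞ (zMap (C.Γ e) k)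
        (C.jetHomeo e k).target := (contDiffOn_zMap e.1.open_target (C.smooth e) k).contMDiffOn
    refine ((contMDiffOn_symm_of_mem_maximalAtlas hmem).comp h1
      (zHomeo e.1.open_target (C.smooth e) k).mapsTo).congr fun u hu => ?_
    change jetInv e k u = jetInv e k (zInv (C.Γ e) k (zMap (C.Γ e) k u))
    rw [zInv_zMap]

/-- Read in the charts Φ, the connecting map is a truncation, which is continuous and linear. -/
lemma LinearConnection.contMDiff_restrict (C : LinearConnection E M) {i j : ℕ} (h : i ≤ j) :
    letI := C.chartedSpace i
    letI := C.chartedSpace j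
    ContMDiff 𝓘(ℝ, Fin (j + 1) → E) 𝓘(ℝ, Fin (i + 1) → E) ∞
      (HigherTangent.restrict h : HigherTangent E M j → HigherTangent E M i) := by
  let _ := C.chartedSpace i
  let _ := C.chartedSpace j
  have : IsManifold 𝓘(ℝ, Fin (i + 1) → E) ∞ (HigherTangent E M i) := C.isManifold i
  have : IsManifold 𝓘(ℝ, Fin (j + 1) → E) ∞ (HigherTangent E M j) := C.isManifold j
  intro p
  have hp := mem_smoothChartAt_source (E := E) p.base
  set e := smoothChartAt E p.base
  have h1 : ContMDiffOn 𝓘(ℝ, Fin (j + 1) → E) 𝓘(ℝ, Fin (i + 1) → E) ∞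
      (truncate E (Nat.add_le_add_right h 1)) (C.chartHomeo e j).target :=
    (truncate E (Nat.add_le_add_right h 1)).contMDiff.contMDiffOn
  have h2 := ((contMDiffOn_symm_of_mem_maximalAtlas (C.chartHomeo_mem e i)).comp h1
    (fun u hu => hu)).comp (contMDiffOn_of_mem_maximalAtlas (C.chartHomeo_mem e j))
      (C.chartHomeo e j).mapsTo
  refine (h2.congr fun q hq => ?_).contMDiffAt ((C.chartHomeo e j).open_source.mem_nhds hp)
  have h3 : C.chartHomeo e i (q.restrict h) =
      truncate E (Nat.add_le_add_right h 1) (C.chartHomeo e j q) := C.chart_restrict e h q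
  rw [Function.comp_apply, Function.comp_apply, ← h3]
  exact ((C.chartHomeo e i).left_inv hq).symm

end Charts

/-! ## Coordinate changes -/

section CoordChange

variable {E : Type u} [NormedAddCommGroup E] [NormedSpace ℝ E]

/-- A continuous endomorphism of `E` acting diagonally on `E^k`, as a function of the
endomorphism. -/
noncomputable def diagCLM (E : Type u) [NormedAddCommGroup E] [NormedSpace ℝ E] (k : ℕ) :
    (E →L[ℝ] E) →L[ℝ] ((Fin k → E) →L[ℝ] (Fin k → E)) :=
  ∑ a : Fin k, (ContinuousLinearMap.compL ℝ (Fin k → E) E (Fin k → E)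
    (ContinuousLinearMap.single ℝ (fun _ : Fin k => E) a)).comp
      ((ContinuousLinearMap.compL ℝ (Fin k → E) E E).flip (ContinuousLinearMap.proj a))

lemma diagCLM_apply (k : ℕ) (L : E →L[ℝ] E) (z : Fin k → E) : diagCLM E k L z = fun a => L (z a) := by
  funext b
  simp [diagCLM, Finset.sum_apply, Pi.single_apply]

/-- A continuous automorphism of `E` acting diagonally on `E^k`. -/
noncomputable def diagCLE (k : ℕ) (L : E ≃L[ℝ] E) : (Fin k → E) ≃L[ℝ] (Fin k → E) :=
  ContinuousLinearEquiv.piCongrRight fun _ => L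

lemma diagCLE_apply (k : ℕ) (L : E ≃L[ℝ] E) (z : Fin k → E) : diagCLE k L z = fun a => L (z a) :=
  rfl

lemma coe_diagCLE (k : ℕ) (L : E ≃L[ℝ] E) :
    (diagCLE k L : (Fin k → E) →L[ℝ] (Fin k → E)) = diagCLM E k L := by
  ext z : 1
  rw [diagCLM_apply]
  rfl

variable {M : Type v} [TopologicalSpace M] [ChartedSpace E M]

/-- The composites agree only as germs, because charts have arbitrary values off their domains; this
suffices for derivatives. -/
lemma SmoothChart.eventuallyEq_comp {e e' e'' : SmoothChart E M} {x : M}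
    (h : x ∈ e.1.source) (h' : x ∈ e'.1.source) :
    e''.1 ∘ e.1.symm =ᶠ[𝓝 (e.1 x)] (e''.1 ∘ e'.1.symm) ∘ (e'.1 ∘ e.1.symm) := by
  filter_upwards [(e.isOpen_overlap e').mem_nhds (SmoothChart.apply_mem_overlap h h')] with y hy
  simp only [Function.comp_apply]
  rw [e'.1.left_inv (SmoothChart.mem_overlap.1 hy).2]

lemma SmoothChart.fderiv_comp {e e' e'' : SmoothChart E M} {x : M}
    (h : x ∈ e.1.source) (h' : x ∈ e'.1.source) (h'' : x ∈ e''.1.source) :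
    (fderiv ℝ (e''.1 ∘ e'.1.symm) (e'.1 x)).comp (fderiv ℝ (e'.1 ∘ e.1.symm) (e.1 x)) =
      fderiv ℝ (e''.1 ∘ e.1.symm) (e.1 x) := by
  have hval : (e'.1 ∘ e.1.symm) (e.1 x) = e'.1 x := by
    rw [Function.comp_apply, e.1.left_inv h]
  have h1 : DifferentiableAt ℝ (e'.1 ∘ e.1.symm) (e.1 x) :=
    ((e.contDiffOn e').differentiableOn (by simp)).differentiableAt
      ((e.isOpen_overlap e').mem_nhds (SmoothChart.apply_mem_overlap h h'))
  have h2 : DifferentiableAt ℝ (e''.1 ∘ e'.1.symm) ((e'.1 ∘ e.1.symm) (e.1 x)) := by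
    rw [hval]
    exact ((e'.contDiffOn e'').differentiableOn (by simp)).differentiableAt
      ((e'.isOpen_overlap e'').mem_nhds (SmoothChart.apply_mem_overlap h' h''))
  rw [(SmoothChart.eventuallyEq_comp (e'' := e'') h h').fderiv_eq, _root_.fderiv_comp _ h2 h1, hval]

lemma SmoothChart.fderiv_self {e : SmoothChart E M} {x : M} (h : x ∈ e.1.source) :
    fderiv ℝ (e.1 ∘ e.1.symm) (e.1 x) = ContinuousLinearMap.id ℝ E := by
  have h1 : e.1 ∘ e.1.symm =ᶠ[𝓝 (e.1 x)] id := by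
    filter_upwards [e.1.open_target.mem_nhds (e.1.map_source h)] with y hy
    exact e.1.right_inv hy
  rw [h1.fderiv_eq, fderiv_id]

open Classical in
/-- The derivative at `x` of the change of charts `e' ∘ e⁻¹` (by convention the identity outside of
the common domain of `e` and `e'`). -/
noncomputable def SmoothChart.coordChange (e e' : SmoothChart E M) (x : M) : E ≃L[ℝ] E :=
  if h : x ∈ e.1.source ∧ x ∈ e'.1.source then
    ContinuousLinearEquiv.equivOfInverse (fderiv ℝ (e'.1 ∘ e.1.symm) (e.1 x))
      (fderiv ℝ (e.1 ∘ e'.1.symm) (e'.1 x))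
      (fun y => by
        rw [← ContinuousLinearMap.comp_apply, SmoothChart.fderiv_comp h.1 h.2 h.1,
          SmoothChart.fderiv_self h.1]
        rfl)
      (fun y => by
        rw [← ContinuousLinearMap.comp_apply, SmoothChart.fderiv_comp h.2 h.1 h.2,
          SmoothChart.fderiv_self h.2]
        rfl)
  else ContinuousLinearEquiv.refl ℝ E

lemma SmoothChart.coe_coordChange {e e' : SmoothChart E M} {x : M}
    (h : x ∈ e.1.source) (h' : x ∈ e'.1.source) :
    (e.coordChange e' x : E →L[ℝ] E) = fderiv ℝ (e'.1 ∘ e.1.symm) (e.1 x) := by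
  rw [SmoothChart.coordChange, dif_pos ⟨h, h'⟩]
  rfl

lemma SmoothChart.coordChange_apply {e e' : SmoothChart E M} {x : M}
    (h : x ∈ e.1.source) (h' : x ∈ e'.1.source) (y : E) :
    e.coordChange e' x y = fderiv ℝ (e'.1 ∘ e.1.symm) (e.1 x) y := by
  rw [← SmoothChart.coe_coordChange h h']
  rfl

lemma SmoothChart.coordChange_trans {e e' e'' : SmoothChart E M} {x : M}
    (h : x ∈ e.1.source) (h' : x ∈ e'.1.source) (h'' : x ∈ e''.1.source) :
    (e.coordChange e' x).trans (e'.coordChange e'' x) = e.coordChange e'' x := by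
  ext y
  rw [ContinuousLinearEquiv.trans_apply, SmoothChart.coordChange_apply h h',
    SmoothChart.coordChange_apply h' h'', SmoothChart.coordChange_apply h h'',
    ← SmoothChart.fderiv_comp h h' h'', ContinuousLinearMap.comp_apply]

/-- The diagonal change of charts, restricted to a fibre. It accounts both for the linearity of all
trivializations and for the form of the transition functions. -/
lemma LinearConnection.chart_succ_eq (C : LinearConnection E M) {e e' : SmoothChart E M} {k : ℕ}
    {p : HigherTangent E M k} (hp : p.base ∈ e.1.source) (hp' : p.base ∈ e'.1.source) :
    (fun a : Fin k => C.chart e' k p a.succ) =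
      diagCLE k (e.coordChange e' p.base) fun a => C.chart e k p a.succ := by
  funext a
  rw [diagCLE_apply]
  beta_reduce
  rw [SmoothChart.coordChange_apply hp hp', C.chart_eq hp hp', diagExtend,
    Fin.cons_succ, C.chart_zero hp]

end CoordChange

/-! ## The Banach vector bundles `T^k M` -/

section BanachBundle

variable {E : Type u} [NormedAddCommGroup E] [NormedSpace ℝ E] [CompleteSpace E]
  {M : Type v} [TopologicalSpace M] [ChartedSpace E M] [IsManifold 𝓘(ℝ, E) ∞ M]
  (C : LinearConnection E M)

lemma LinearConnection.contMDiffOn_trivialization (e : SmoothChart E M) (k : ℕ) :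
    letI := C.chartedSpace k
    ContMDiffOn 𝓘(ℝ, Fin (k + 1) → E) (𝓘(ℝ, E).prod 𝓘(ℝ, Fin k → E)) ∞
      (fun p : HigherTangent E M k => (p.base, fun a : Fin k => C.chart e k p a.succ))
      {p | p.base ∈ e.1.source} := by
  let _ := C.chartedSpace k
  have : IsManifold 𝓘(ℝ, Fin (k + 1) → E) ∞ (HigherTangent E M k) := C.isManifold k
  have hc : ContMDiffOn 𝓘(ℝ, Fin (k + 1) → E) 𝓘(ℝ, Fin (k + 1) → E) ∞ (C.chartHomeo e k)
    {p | p.base ∈ e.1.source} := contMDiffOn_of_mem_maximalAtlas (C.chartHomeo_mem e k)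
  refine ContMDiffOn.prodMk ?_ ?_
  · have h0 : ContMDiff 𝓘(ℝ, Fin (k + 1) → E) 𝓘(ℝ, E) ∞ (fun u : Fin (k + 1) → E => u 0) :=
      (contDiff_apply ℝ E (0 : Fin (k + 1))).contMDiff
    refine ((contMDiffOn_symm_of_mem_maximalAtlas e.2).comp (h0.comp_contMDiffOn hc)
      fun p hp => ?_).congr fun p hp => ?_
    · exact (C.chartHomeo e k).map_source hp
    · change p.base = e.1.symm (C.chart e k p 0)
      rw [C.chart_zero hp, e.1.left_inv hp]
  · have h1 : ContMDiff 𝓘(ℝ, Fin (k + 1) → E) 𝓘(ℝ, Fin k → E) ∞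
        (fun (u : Fin (k + 1) → E) (a : Fin k) => u a.succ) :=
      (contDiff_pi.2 fun a => contDiff_apply ℝ E _).contMDiff
    exact h1.comp_contMDiffOn hc

lemma LinearConnection.contMDiffOn_trivialization_symm (e : SmoothChart E M) (k : ℕ) :
    letI := C.chartedSpace k
    ContMDiffOn (𝓘(ℝ, E).prod 𝓘(ℝ, Fin k → E)) 𝓘(ℝ, Fin (k + 1) → E) ∞
      (fun q : M × (Fin k → E) => (C.chartHomeo e k).symm
        (Fin.cons (α := fun _ => E) (e.1 q.1) q.2)) (e.1.source ×ˢ univ) := by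
  let _ := C.chartedSpace k
  have : IsManifold 𝓘(ℝ, Fin (k + 1) → E) ∞ (HigherTangent E M k) := C.isManifold k
  have h1 : ContMDiffOn (𝓘(ℝ, E).prod 𝓘(ℝ, Fin k → E)) 𝓘(ℝ, E) ∞
      (fun q : M × (Fin k → E) => e.1 q.1) (e.1.source ×ˢ univ) :=
    (contMDiffOn_of_mem_maximalAtlas e.2).comp contMDiffOn_fst fun q hq => hq.1
  refine (contMDiffOn_symm_of_mem_maximalAtlas (C.chartHomeo_mem e k)).comp
    (contMDiffOn_pi_space.2 fun i => ?_) fun q hq => ?_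
  · refine Fin.cases ?_ (fun i => ?_) i
    · simpa using h1
    · simp only [Fin.cons_succ]
      exact (contMDiff_pi_space.1 contMDiff_snd i).contMDiffOn
  · exact e.1.map_source hq.1

/-- The trivialization `(e⁻¹ × id) ∘ Φ_e^k` of `T^k M` over the domain of `e`. -/
noncomputable def LinearConnection.trivialization (e : SmoothChart E M) (k : ℕ) :
    Bundle.Trivialization (Fin k → E) (fun p : HigherTangent E M k => p.base) where
  toFun p := (p.base, fun a : Fin k => C.chart e k p a.succ)
  invFun q := (C.chartHomeo e k).symm (Fin.cons (α := fun _ => E) (e.1 q.1) q.2)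
  source := {p | p.base ∈ e.1.source}
  target := e.1.source ×ˢ univ
  map_source' p hp := ⟨hp, trivial⟩
  map_target' q hq := by
    rw [mem_ofPred_eq, C.chartHomeo_symm_base, Fin.cons_zero]
    exact e.1.map_target (e.1.map_source hq.1)
  left_inv' p hp := by
    have h : Fin.cons (α := fun _ => E) (e.1 p.base) (fun a : Fin k => C.chart e k p a.succ) =
        C.chartHomeo e k p := by
      rw [← C.chart_zero hp]
      exact Fin.cons_self_tail _
    rw [h]
    exact (C.chartHomeo e k).left_inv hp
  right_inv' q hq := by
    have h : C.chart e k ((C.chartHomeo e k).symm (Fin.cons (α := fun _ => E) (e.1 q.1) q.2)) =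
        Fin.cons (α := fun _ => E) (e.1 q.1) q.2 :=
      (C.chartHomeo e k).right_inv (e.1.map_source hq.1)
    ext1
    · change ((C.chartHomeo e k).symm _).base = q.1
      rw [C.chartHomeo_symm_base, Fin.cons_zero, e.1.left_inv hq.1]
    · simp only [h, Fin.cons_succ]
  open_source := (C.chartHomeo e k).open_source
  open_target := e.1.open_source.prod isOpen_univ
  continuousOn_toFun :=
    letI := C.chartedSpace k
    (C.contMDiffOn_trivialization e k).continuousOn
  continuousOn_invFun :=
    letI := C.chartedSpace k
    (C.contMDiffOn_trivialization_symm e k).continuousOn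
  baseSet := e.1.source
  open_baseSet := e.1.open_source
  source_eq := rfl
  target_eq := rfl
  proj_toFun _ _ := rfl

/-- The identification of the fibre of `T^k M` over `x` with `E^k`, by the chart of `M` at `x`. -/
noncomputable def LinearConnection.fibreEquiv (k : ℕ) (x : M) :
    {p : HigherTangent E M k // p.base = x} ≃ (Fin k → E) where
  toFun p := (C.trivialization (smoothChartAt E x) k p.1).2
  invFun ξ := ⟨(C.trivialization (smoothChartAt E x) k).toOpenPartialHomeomorph.symm (x, ξ),
    (C.trivialization (smoothChartAt E x) k).proj_symm_apply' (mem_smoothChartAt_source x)⟩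
  left_inv p := by
    obtain ⟨p, rfl⟩ := p
    exact Subtype.ext ((C.trivialization (smoothChartAt E p.base) k).symm_apply_mk_proj
      (mem_smoothChartAt_source p.base))
  right_inv ξ := congrArg Prod.snd
    ((C.trivialization (smoothChartAt E x) k).apply_symm_apply' (mem_smoothChartAt_source x))

/-- `T^k M` as a Banach vector bundle over `M`. -/
noncomputable def LinearConnection.bundle (k : ℕ) :
    letI := C.chartedSpace k
    BanachBundle E (SmoothChart E M) (Fin k → E) (Fin (k + 1) → E)
      (fun p : HigherTangent E M k => p.base) :=
  letI := C.chartedSpace k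
  { triv := fun e => C.trivialization e k
    cover := fun x => ⟨smoothChartAt E x, mem_smoothChartAt_source x⟩
    smooth_triv := fun e => C.contMDiffOn_trivialization e k
    smooth_triv_symm := fun e => C.contMDiffOn_trivialization_symm e k
    fibreAdd := fun x => (C.fibreEquiv k x).addCommGroup
    fibreModule := fun x =>
      letI := (C.fibreEquiv k x).addCommGroup
      (C.fibreEquiv k x).module ℝ
    linear := fun e x hx => by
      let _ := (C.fibreEquiv k x).addCommGroup
      let _ := (C.fibreEquiv k x).module ℝ
      -- The vector space structure of the fibre is transported from E^k by the preferred chart at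
      -- x. Any other trivialization differs from that one by a diagonal linear automorphism.
      have h : (fun p : {p : HigherTangent E M k // p.base = x} => (C.trivialization e k p.1).2) =
          ((diagCLE k ((smoothChartAt E x).coordChange e x)).toLinearEquiv.toLinearMap).comp
            ((C.fibreEquiv k x).linearEquiv ℝ).toLinearMap := by
        funext p
        obtain ⟨p, rfl⟩ := p
        exact C.chart_succ_eq (mem_smoothChartAt_source p.base) hx
      rw [h]
      exact LinearMap.isLinear _
    transition := fun e e' x => diagCLE k (e.coordChange e' x)
    transition_smooth := fun e e' => by
      have h1 : ContMDiffOn 𝓘(ℝ, E) 𝓘(ℝ, (Fin k → E) →L[ℝ] (Fin k → E)) ∞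
          (fun y => diagCLM E k (fderiv ℝ (e'.1 ∘ e.1.symm) y)) (e.overlap e') :=
        ((diagCLM E k).contDiff.comp_contDiffOn
          ((e.contDiffOn e').fderiv_of_isOpen (m := ∞) (e.isOpen_overlap e')
            (by simp))).contMDiffOn
      refine (h1.comp ((contMDiffOn_of_mem_maximalAtlas e.2).mono inter_subset_left)
        fun x hx => SmoothChart.apply_mem_overlap hx.1 hx.2).congr fun x hx => ?_
      rw [coe_diagCLE, SmoothChart.coe_coordChange hx.1 hx.2]
      rfl
    transition_spec := fun e e' p hp hp' => C.chart_succ_eq hp hp' }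

end BanachBundle

/-! ## The limit `T^∞ M` -/

section Infinite

variable {E : Type u} [NormedAddCommGroup E] [NormedSpace ℝ E]
  {M : Type v} [TopologicalSpace M] [ChartedSpace E M]

lemma InfTangent.restrict_toOrder (p : InfTangent E M) {i j : ℕ} (h : i ≤ j) :
    (p.toOrder j).restrict h = p.toOrder i := by
  obtain ⟨x, q⟩ := p
  induction q using Quotient.inductionOn with
  | h γ => rfl

lemma InfTangent.continuous_toOrder (k : ℕ) :
    Continuous (InfTangent.toOrder k : InfTangent E M → HigherTangent E M k) :=
  continuous_iInf_dom (i := k) continuous_induced_dom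

lemma InfTangent.ext_toOrder {p q : InfTangent E M} (h : ∀ k, p.toOrder k = q.toOrder k) :
    p = q := by
  obtain ⟨x, p⟩ := p
  obtain ⟨y, q⟩ := q
  obtain rfl : x = y := congrArg HigherTangent.base (h 0)
  induction p using Quotient.inductionOn with
  | h γ₁ =>
    induction q using Quotient.inductionOn with
    | h γ₂ =>
      congr 1
      refine Quotient.sound (s := curveSetoidInf E x) fun k => ?_
      have h1 := h k
      simp only [InfTangent.toOrder, HigherTangent.mk.injEq, heq_eq_eq, true_and] at h1
      exact Quotient.exact (s := curveSetoid E k x) h1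

/-- The map from `T^∞ M` to the projective limit of the `T^k M`. -/
def InfTangent.toLim (p : InfTangent E M) : TangentLim E M :=
  ⟨fun k => p.toOrder k, fun _ _ h => p.restrict_toOrder h⟩

/-- Both topologies are the infimum over k of those induced from T^k M. -/
lemma InfTangent.isInducing_toLim :
    Topology.IsInducing (InfTangent.toLim : InfTangent E M → TangentLim E M) := by
  constructor
  change (⨅ k : ℕ, TopologicalSpace.induced (InfTangent.toOrder k) _) =
    TopologicalSpace.induced _ (TopologicalSpace.induced _ Pi.topologicalSpace)
  rw [induced_compose, Pi.topologicalSpace, induced_iInf]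
  simp only [induced_compose]
  rfl

/-- The limit `Φ_e^∞` of the maps `Φ_e^k`. -/
noncomputable def LinearConnection.limChart (C : LinearConnection E M) (e : SmoothChart E M)
    (p : InfTangent E M) : PowerLim E 1 :=
  ⟨fun k => C.chart e k (p.toOrder k), fun i j h => by
    rw [← C.chart_restrict e h, p.restrict_toOrder h]⟩

variable [CompleteSpace E]

lemma InfTangent.bijective_toLim [IsManifold 𝓘(ℝ, E) ∞ M] (C : LinearConnection E M) :
    Function.Bijective (InfTangent.toLim : InfTangent E M → TangentLim E M) := by
  refine ⟨fun p q h => InfTangent.ext_toOrder fun k => congrFun (congrArg Subtype.val h) k,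
    fun P => ?_⟩
  have hbase : ∀ k, (P.1 k).base = (P.1 0).base := fun k =>
    congrArg HigherTangent.base (P.2 0 k (Nat.zero_le k))
  have he := mem_smoothChartAt_source (E := E) (P.1 0).base
  set e := smoothChartAt E (P.1 0).base
  have he' : ∀ k, (P.1 k).base ∈ e.1.source := fun k => by rwa [hbase k]
  -- The j-th coefficient is read off as the top one of the j-th member of the thread; compatibility
  -- of the thread gives the lower coefficients of all members. Borel's lemma then supplies a curve.
  let a : ℕ → E := fun j => jetChart e j (P.1 j) (Fin.last j)
  have ha0 : a 0 = e.1 (P.1 0).base := jetChart_zero (he' 0)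
  have ha : a 0 ∈ e.1.target := by
    rw [ha0]
    exact e.1.map_source he
  refine ⟨e.pointOfCoeffs a, Subtype.ext (funext fun k => ?_)⟩
  refine jetChart_injOn C (e := e) ?_ (he' k) ?_
  · change (e.pointOfCoeffs a).base ∈ _
    rw [e.pointOfCoeffs_base]
    exact e.1.map_target ha
  · refine (e.jetChart_pointOfCoeffs a ha k).trans (funext fun j => ?_)
    have hj : (j : ℕ) ≤ k := Nat.lt_succ_iff.1 j.2
    simp only [a]
    rw [← P.2 j k hj, jetChart_restrict]
    rfl

/-- `T^∞ M` is homeomorphic to the projective limit of the `T^k M`. -/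
noncomputable def InfTangent.homeoLim [IsManifold 𝓘(ℝ, E) ∞ M] (C : LinearConnection E M) :
    InfTangent E M ≃ₜ TangentLim E M :=
  (Equiv.ofBijective _ (InfTangent.bijective_toLim C)).toHomeomorphOfIsInducing
    InfTangent.isInducing_toLim

/-- The inverse of `Φ_e^∞`. -/
noncomputable def LinearConnection.limChartInv (C : LinearConnection E M) (e : SmoothChart E M)
    (ξ : PowerLim E 1) : InfTangent E M :=
  e.pointOfCoeffs fun j => zInv (C.Γ e) j (ξ.1 j) (Fin.last j)

lemma LinearConnection.limChartInv_base (C : LinearConnection E M) (e : SmoothChart E M)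
    (ξ : PowerLim E 1) : (C.limChartInv e ξ).base = e.1.symm (ξ.1 0 0) := by
  rw [LinearConnection.limChartInv, e.pointOfCoeffs_base]
  rfl

lemma LinearConnection.chart_limChartInv (C : LinearConnection E M) {e : SmoothChart E M}
    {ξ : PowerLim E 1} (h : ξ.1 0 0 ∈ e.1.target) (k : ℕ) :
    C.chart e k ((C.limChartInv e ξ).toOrder k) = ξ.1 k := by
  have h1 : jetChart e k ((C.limChartInv e ξ).toOrder k) = zInv (C.Γ e) k (ξ.1 k) := by
    refine (e.jetChart_pointOfCoeffs _ h k).trans (funext fun j => ?_)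
    have hj : (j : ℕ) ≤ k := Nat.lt_succ_iff.1 j.2
    -- `zInv` commutes with truncation because its inverse `zMap` does. So the top coefficients used
    -- in `limChartInv` fit together to one Taylor sequence.
    have h2 : truncate E (Nat.add_le_add_right hj 1) (zInv (C.Γ e) k (ξ.1 k)) =
        zInv (C.Γ e) j (ξ.1 j) := by
      rw [← zInv_zMap (C.Γ e) j (truncate E (Nat.add_le_add_right hj 1) _),
        ← zMap_truncate (C.Γ e) hj, zMap_zInv, ξ.2 j k hj]
    exact (congrFun h2 (Fin.last j)).symm
  rw [LinearConnection.chart, h1, zMap_zInv]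

lemma LinearConnection.toOrder_limChartInv (C : LinearConnection E M) {e : SmoothChart E M}
    {ξ : PowerLim E 1} (h : ξ.1 0 0 ∈ e.1.target) (k : ℕ) :
    (C.limChartInv e ξ).toOrder k = (C.chartHomeo e k).symm (ξ.1 k) := by
  have h1 : ((C.limChartInv e ξ).toOrder k).base ∈ e.1.source := by
    change (C.limChartInv e ξ).base ∈ e.1.source
    rw [C.limChartInv_base]
    exact e.1.map_target h
  rw [← C.chart_limChartInv h k]
  exact ((C.chartHomeo e k).left_inv h1).symm

/-- The chart `Φ_e^∞` of `T^∞ M`. -/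
noncomputable def LinearConnection.limChartHomeo (C : LinearConnection E M) (e : SmoothChart E M) :
    OpenPartialHomeomorph (InfTangent E M) (PowerLim E 1) where
  toFun := C.limChart e
  invFun := C.limChartInv e
  source := {p | p.base ∈ e.1.source}
  target := {ξ | ξ.1 0 0 ∈ e.1.target}
  map_source' p hp := (C.chartHomeo e 0).map_source (x := p.toOrder 0) hp
  map_target' ξ hξ := by
    rw [mem_ofPred_eq, C.limChartInv_base]
    exact e.1.map_target hξ
  left_inv' p hp := InfTangent.ext_toOrder fun k => by
    have h : (C.limChart e p).1 0 0 ∈ e.1.target :=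
      (C.chartHomeo e 0).map_source (x := p.toOrder 0) hp
    rw [C.toOrder_limChartInv h]
    exact (C.chartHomeo e k).left_inv hp
  right_inv' ξ hξ := Subtype.ext (funext fun k => C.chart_limChartInv hξ k)
  open_source := (C.chartHomeo e 0).open_source.preimage (InfTangent.continuous_toOrder 0)
  open_target := e.1.open_target.preimage
    ((continuous_apply (0 : Fin 1)).comp (PowerLim.proj E 1 0).continuous)
  continuousOn_toFun := by
    rw [continuousOn_iff_continuous_domRestrict]
    refine Continuous.subtype_mk (continuous_pi fun k => ?_) _
    have h : ContinuousOn (fun p : InfTangent E M => C.chart e k (p.toOrder k))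
        {p | p.base ∈ e.1.source} := (C.chartHomeo e k).continuousOn.comp
      (InfTangent.continuous_toOrder k).continuousOn fun p hp => hp
    exact continuousOn_iff_continuous_domRestrict.1 h
  continuousOn_invFun := by
    rw [continuousOn_iff_continuous_domRestrict]
    refine continuous_iInf_rng.2 fun k => continuous_induced_rng.2 ?_
    have h : ContinuousOn (fun ξ : PowerLim E 1 => (C.limChartInv e ξ).toOrder k)
        {ξ | ξ.1 0 0 ∈ e.1.target} := by
      refine ((C.chartHomeo e k).continuousOn_symm.comp
        (PowerLim.proj E 1 k).continuous.continuousOn fun ξ hξ => ?_).congr fun ξ hξ =>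
          C.toOrder_limChartInv hξ k
      rw [C.chartHomeo_target, mem_ofPred_eq, PowerLim.proj_apply, powerLim_apply_zero]
      exact hξ
    exact continuousOn_iff_continuous_domRestrict.1 h

lemma LinearConnection.limChartHomeo_symm_base (C : LinearConnection E M) (e : SmoothChart E M)
    (ξ : PowerLim E 1) : ((C.limChartHomeo e).symm ξ).base = e.1.symm (ξ.1 0 0) :=
  C.limChartInv_base e ξ

lemma LinearConnection.limChart_limChartInv (C : LinearConnection E M) {e e' : SmoothChart E M}
    {ξ : PowerLim E 1} (h : ξ.1 0 0 ∈ e.overlap e') (k : ℕ) :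
    C.chart e' k ((C.limChartInv e ξ).toOrder k) =
      diagExtend (e'.1 ∘ e.1.symm) k (ξ.1 k) := by
  obtain ⟨h1, h2⟩ := SmoothChart.mem_overlap.1 h
  rw [← C.limChartInv_base] at h2
  rw [C.chart_eq (e := e) (p := (C.limChartInv e ξ).toOrder k) ?_ h2, C.chart_limChartInv h1]
  change (C.limChartInv e ξ).base ∈ e.1.source
  rw [C.limChartInv_base]
  exact e.1.map_target h1

/-- The manifold structure of `T^∞ M`, given by the charts `Φ_e^∞`. -/
noncomputable def LinearConnection.limAtlas [IsManifold 𝓘(ℝ, E) ∞ M] (C : LinearConnection E M) :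
    FrechetAtlas (SmoothChart E M) (PowerLim E 1) (InfTangent E M) where
  chart := C.limChartHomeo
  cover p := ⟨smoothChartAt E p.base, mem_smoothChartAt_source p.base⟩
  compatible e e' n := by
    have hsub : ∀ ξ ∈ ((C.limChartHomeo e).symm ≫ₕ C.limChartHomeo e').source,
        ξ.1 0 0 ∈ e.overlap e' := by
      intro ξ hξ
      rw [OpenPartialHomeomorph.trans_source] at hξ
      have h2 : (C.limChartInv e ξ).base ∈ e'.1.source := hξ.2
      rw [C.limChartInv_base] at h2
      exact SmoothChart.mem_overlap.2 ⟨hξ.1, h2⟩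
    have hopen := ((C.limChartHomeo e).symm ≫ₕ C.limChartHomeo e').open_source
    -- The k-th component of the transition map depends only on the k-th component of ξ and is the
    -- Banach space transition map of T^k M.
    refine frechetCkOn_powerLim n hopen
      (fun k => isOpen_base_preimage (e.isOpen_overlap e') k)
      (fun k => contDiffOn_diagExtend (e.isOpen_overlap e') (e.contDiffOn e') k)
      (fun k => PowerLim.proj E 1 k) (fun k ξ hξ => ?_)
      fun ξ hξ k => C.limChart_limChartInv (hsub ξ hξ) k
    rw [mem_ofPred_eq, PowerLim.proj_apply, powerLim_apply_zero]
    exact hsub ξ hξ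

/-- Two points over the same base point lie in one chart domain and are separated there, in a
Hausdorff model space. Points over different base points are separated by preimages of open sets of
M. -/
lemma LinearConnection.t2Space [IsManifold 𝓘(ℝ, E) ∞ M] [T2Space M] (C : LinearConnection E M) :
    T2Space (InfTangent E M) := by
  have hcont : Continuous fun p : InfTangent E M => p.base := by
    rw [continuous_iff_continuousAt]
    intro p
    have hp := mem_smoothChartAt_source (E := E) p.base
    set e := smoothChartAt E p.base
    have h1 : ContinuousOn (fun q : InfTangent E M => e.1.symm ((C.limChartHomeo e q).1 0 0))
        (C.limChartHomeo e).source :=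
      e.1.continuousOn_symm.comp (((continuous_apply (0 : Fin 1)).comp
        (PowerLim.proj E 1 0).continuous).comp_continuousOn (C.limChartHomeo e).continuousOn)
        fun q hq => (C.limChartHomeo e).map_source hq
    refine (h1.congr fun q hq => ?_).continuousAt ((C.limChartHomeo e).open_source.mem_nhds hp)
    rw [← C.limChartHomeo_symm_base, (C.limChartHomeo e).left_inv hq]
  refine ⟨fun p q hpq => ?_⟩
  by_cases hb : p.base = q.base
  · have hp : p ∈ (C.limChartHomeo (smoothChartAt E p.base)).source :=
      mem_smoothChartAt_source (E := E) p.base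
    have hq : q ∈ (C.limChartHomeo (smoothChartAt E p.base)).source := by
      change q.base ∈ (smoothChartAt E p.base).1.source
      rw [← hb]
      exact mem_smoothChartAt_source (E := E) p.base
    set c := C.limChartHomeo (smoothChartAt E p.base)
    obtain ⟨U, V, hU, hV, hpU, hqV, hd⟩ := t2_separation fun h => hpq (c.injOn hp hq h)
    exact ⟨c.source ∩ c ⁻¹' U, c.source ∩ c ⁻¹' V, c.isOpen_inter_preimage hU,
      c.isOpen_inter_preimage hV, ⟨hp, hpU⟩, ⟨hq, hqV⟩,
      (hd.preimage c).mono inter_subset_right inter_subset_right⟩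
  · obtain ⟨U, V, hU, hV, hpU, hqV, hd⟩ := t2_separation hb
    exact ⟨_, _, hU.preimage hcont, hV.preimage hcont, hpU, hqV, hd.preimage _⟩

end Infinite

/-! ## The generalized Fréchet vector bundle `T^∞ M` -/

section FrechetBundle

/-- The element of `lim H_i^0` given by the diagonal action of an automorphism of `E`. -/
noncomputable def autDiag {E : Type u} [NormedAddCommGroup E] [NormedSpace ℝ E] (L : E ≃L[ℝ] E) :
    AutLim E :=
  ⟨fun _ => ⟨fun j => diagCLE j L, fun _ _ _ _ => rfl⟩, fun _ _ _ _ => rfl⟩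

/-- The projection `lim E^(i+1) → lim E^i` that forgets the base point. -/
def PowerLim.tail {E : Type u} [NormedAddCommGroup E] [NormedSpace ℝ E] (ξ : PowerLim E 1) :
    PowerLim E 0 :=
  ⟨fun k (a : Fin k) => ξ.1 k a.succ, fun i j h => funext fun (a : Fin i) =>
    congrFun (ξ.2 i j h) a.succ⟩

/-- The point of `lim E^(i+1)` with the base point `y` and the fibre components `ξ`. -/
def PowerLim.cons {E : Type u} [NormedAddCommGroup E] [NormedSpace ℝ E] (y : E)
    (ξ : PowerLim E 0) : PowerLim E 1 :=
  ⟨fun k => Fin.cons (α := fun _ => E) y (ξ.1 k), fun i j h => funext fun a =>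
    Fin.cases rfl (fun a => congrFun (ξ.2 i j h) a) a⟩

lemma PowerLim.cons_tail {E : Type u} [NormedAddCommGroup E] [NormedSpace ℝ E]
    (ξ : PowerLim E 1) : PowerLim.cons (ξ.1 0 0) (PowerLim.tail ξ) = ξ := by
  refine Subtype.ext (funext fun k => funext fun a => Fin.cases ?_ (fun a => rfl) a)
  exact (powerLim_apply_zero ξ k).symm

lemma PowerLim.continuous_tail {E : Type u} [NormedAddCommGroup E] [NormedSpace ℝ E] :
    Continuous (PowerLim.tail : PowerLim E 1 → PowerLim E 0) :=
  Continuous.subtype_mk (continuous_pi fun k => continuous_pi fun (a : Fin k) =>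
    (continuous_apply a.succ).comp (PowerLim.proj E 1 k).continuous) _

lemma PowerLim.continuous_cons {E : Type u} [NormedAddCommGroup E] [NormedSpace ℝ E] :
    Continuous fun q : E × PowerLim E 0 => PowerLim.cons q.1 q.2 := by
  refine Continuous.subtype_mk (continuous_pi fun k => continuous_pi fun a => ?_) _
  refine Fin.cases ?_ (fun (a : Fin k) => ?_) a
  · exact continuous_fst
  · exact (continuous_apply a).comp ((PowerLim.proj E 0 k).continuous.comp continuous_snd)

variable {E : Type u} [NormedAddCommGroup E] [NormedSpace ℝ E]
  {M : Type v} [TopologicalSpace M] [ChartedSpace E M] (C : LinearConnection E M)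

lemma LinearConnection.limChart_zero {e : SmoothChart E M} {p : InfTangent E M}
    (hp : p.base ∈ e.1.source) : (C.limChart e p).1 0 0 = e.1 p.base :=
  C.chart_zero (p := p.toOrder 0) hp

lemma LinearConnection.tail_limChart {e e' : SmoothChart E M} {p : InfTangent E M}
    (hp : p.base ∈ e.1.source) (hp' : p.base ∈ e'.1.source) :
    PowerLim.tail (C.limChart e' p) =
      autLimAct (autDiag (e.coordChange e' p.base)) (PowerLim.tail (C.limChart e p)) :=
  Subtype.ext (funext fun k => C.chart_succ_eq (p := p.toOrder k) hp hp')

variable [CompleteSpace E]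

/-- The limit `τ_e^∞` of the trivializations of the `T^k M`. -/
noncomputable def LinearConnection.limTrivialization (e : SmoothChart E M) :
    Bundle.Trivialization (PowerLim E 0) (fun p : InfTangent E M => p.base) where
  toFun p := (p.base, PowerLim.tail (C.limChart e p))
  invFun q := (C.limChartHomeo e).symm (PowerLim.cons (e.1 q.1) q.2)
  source := {p | p.base ∈ e.1.source}
  target := e.1.source ×ˢ univ
  map_source' p hp := ⟨hp, trivial⟩
  map_target' q hq := (C.limChartHomeo e).map_target (e.1.map_source hq.1)
  left_inv' p hp := by
    rw [← C.limChart_zero hp, PowerLim.cons_tail]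
    exact (C.limChartHomeo e).left_inv hp
  right_inv' q hq := by
    have h : C.limChart e ((C.limChartHomeo e).symm (PowerLim.cons (e.1 q.1) q.2)) =
        PowerLim.cons (e.1 q.1) q.2 :=
      (C.limChartHomeo e).right_inv (e.1.map_source hq.1)
    ext1
    · change ((C.limChartHomeo e).symm _).base = q.1
      rw [C.limChartHomeo_symm_base]
      exact e.1.left_inv hq.1
    · change PowerLim.tail _ = _
      rw [h]
      rfl
  open_source := (C.limChartHomeo e).open_source
  open_target := e.1.open_source.prod isOpen_univ
  continuousOn_toFun := by
    refine ContinuousOn.prodMk ?_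
      (PowerLim.continuous_tail.comp_continuousOn (C.limChartHomeo e).continuousOn)
    have h1 : ContinuousOn (fun q : InfTangent E M => e.1.symm ((C.limChartHomeo e q).1 0 0))
        (C.limChartHomeo e).source :=
      e.1.continuousOn_symm.comp (((continuous_apply (0 : Fin 1)).comp
        (PowerLim.proj E 1 0).continuous).comp_continuousOn (C.limChartHomeo e).continuousOn)
        fun q hq => (C.limChartHomeo e).map_source hq
    refine h1.congr fun q hq => ?_
    beta_reduce
    rw [← C.limChartHomeo_symm_base, (C.limChartHomeo e).left_inv hq]
  continuousOn_invFun := by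
    refine (C.limChartHomeo e).continuousOn_symm.comp
      (PowerLim.continuous_cons.comp_continuousOn (f := fun q : M × PowerLim E 0 => (e.1 q.1, q.2))
        ((e.1.continuousOn.comp continuousOn_fst fun q hq => hq.1).prodMk continuousOn_snd))
      fun q hq => e.1.map_source hq.1
  baseSet := e.1.source
  open_baseSet := e.1.open_source
  source_eq := rfl
  target_eq := rfl
  proj_toFun _ _ := rfl

lemma LinearConnection.frechetSmoothOn_limTrivialization (e₁ e₂ e₃ : SmoothChart E M) :
    FrechetSmoothOn
      (fun ξ : PowerLim E 1 => (e₃.1 ((C.limChartHomeo e₂).symm ξ).base,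
        (C.limTrivialization e₁ ((C.limChartHomeo e₂).symm ξ)).2))
      {ξ | ξ ∈ (C.limChartHomeo e₂).target ∧ ((C.limChartHomeo e₂).symm ξ).base ∈ e₁.1.source ∧
        ((C.limChartHomeo e₂).symm ξ).base ∈ e₃.1.source} := by
  intro n
  -- All three conditions concern the base point alone, so the domain is the preimage of an open
  -- subset of E under the base coordinate.
  have hset : {ξ | ξ ∈ (C.limChartHomeo e₂).target ∧
      ((C.limChartHomeo e₂).symm ξ).base ∈ e₁.1.source ∧
        ((C.limChartHomeo e₂).symm ξ).base ∈ e₃.1.source} =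
      {ξ : PowerLim E 1 | ξ.1 0 0 ∈ e₂.overlap e₁ ∩ e₂.overlap e₃} := by
    ext ξ
    simp only [mem_ofPred_eq, C.limChartHomeo_symm_base, mem_inter_iff, SmoothChart.mem_overlap]
    exact ⟨fun h => ⟨⟨h.1, h.2.1⟩, h.1, h.2.2⟩, fun h => ⟨h.1.1, h.1.2, h.2.2⟩⟩
  rw [hset]
  let L : PowerLim E 1 →L[ℝ] E := (ContinuousLinearMap.proj (R := ℝ) (φ := fun _ : Fin 1 => E)
    0).comp (PowerLim.proj E 1 0)
  have hopen : IsOpen {ξ : PowerLim E 1 | ξ.1 0 0 ∈ e₂.overlap e₁ ∩ e₂.overlap e₃} :=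
    ((e₂.isOpen_overlap e₁).inter (e₂.isOpen_overlap e₃)).preimage L.continuous
  refine FrechetCkOn.prodMk n ?_ ?_
  · refine frechetCkOn_of_contDiffOn n (e₂.isOpen_overlap e₃) (e₂.contDiffOn e₃) L hopen
      (fun ξ hξ => hξ.2) fun ξ hξ => ?_
    rw [C.limChartHomeo_symm_base]
    rfl
  · have hg : ∀ k, ContDiffOn ℝ ∞ (fun (z : Fin (k + 1) → E) (a : Fin k) =>
        diagExtend (e₁.1 ∘ e₂.1.symm) k z a.succ) {z | z 0 ∈ e₂.overlap e₁} :=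
      fun k => contDiffOn_pi.2 fun a => contDiffOn_pi.1
        (contDiffOn_diagExtend (e₂.isOpen_overlap e₁) (e₂.contDiffOn e₁) k) a.succ
    refine frechetCkOn_powerLim n (d := 0) hopen
      (fun k => isOpen_base_preimage (e₂.isOpen_overlap e₁) k) hg
      (fun k => PowerLim.proj E 1 k) (fun k ξ hξ => ?_)
      fun ξ hξ k => funext fun (a : Fin k) => ?_
    · rw [mem_ofPred_eq, PowerLim.proj_apply, powerLim_apply_zero]
      exact hξ.1
    · exact congrFun (C.limChart_limChartInv hξ.1 k) a.succ

lemma LinearConnection.frechetSmoothOn_limTrivialization_symm (e₁ e₂ e₃ : SmoothChart E M) :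
    FrechetSmoothOn
      (fun q : E × PowerLim E 0 => C.limChartHomeo e₂
        ((C.limTrivialization e₁).toOpenPartialHomeomorph.symm (e₃.1.symm q.1, q.2)))
      {q | q.1 ∈ e₃.1.target ∧ e₃.1.symm q.1 ∈ (C.limTrivialization e₁).baseSet ∧
        (C.limTrivialization e₁).toOpenPartialHomeomorph.symm (e₃.1.symm q.1, q.2) ∈
          (C.limChartHomeo e₂).source} := by
  intro n
  have hbase : ∀ q : E × PowerLim E 0, e₃.1.symm q.1 ∈ e₁.1.source →
      ((C.limTrivialization e₁).toOpenPartialHomeomorph.symm (e₃.1.symm q.1, q.2)).base =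
        e₃.1.symm q.1 := fun q hq => (C.limTrivialization e₁).proj_symm_apply' hq
  have hset : {q : E × PowerLim E 0 | q.1 ∈ e₃.1.target ∧
      e₃.1.symm q.1 ∈ (C.limTrivialization e₁).baseSet ∧
        (C.limTrivialization e₁).toOpenPartialHomeomorph.symm (e₃.1.symm q.1, q.2) ∈
          (C.limChartHomeo e₂).source} =
      {q | q.1 ∈ e₃.overlap e₁ ∩ e₃.overlap e₂} := by
    ext q
    constructor
    · rintro ⟨h1, h2, h3⟩
      have h4 : ((C.limTrivialization e₁).toOpenPartialHomeomorph.symm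
        (e₃.1.symm q.1, q.2)).base ∈ e₂.1.source := h3
      rw [hbase q h2] at h4
      exact ⟨SmoothChart.mem_overlap.2 ⟨h1, h2⟩, SmoothChart.mem_overlap.2 ⟨h1, h4⟩⟩
    · rintro ⟨h1, h2⟩
      obtain ⟨h1, h3⟩ := SmoothChart.mem_overlap.1 h1
      refine ⟨h1, h3, ?_⟩
      change ((C.limTrivialization e₁).toOpenPartialHomeomorph.symm
        (e₃.1.symm q.1, q.2)).base ∈ e₂.1.source
      rw [hbase q h3]
      exact (SmoothChart.mem_overlap.1 h2).2
  rw [hset]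
  have hV : IsOpen (e₃.overlap e₁ ∩ e₃.overlap e₂) :=
    (e₃.isOpen_overlap e₁).inter (e₃.isOpen_overlap e₂)
  have hopen : IsOpen {q : E × PowerLim E 0 | q.1 ∈ e₃.overlap e₁ ∩ e₃.overlap e₂} :=
    hV.preimage continuous_fst
  have hmem : ∀ y ∈ e₃.overlap e₁ ∩ e₃.overlap e₂, (e₁.1 ∘ e₃.1.symm) y ∈ e₁.overlap e₂ :=
    fun y hy => SmoothChart.apply_mem_overlap (SmoothChart.mem_overlap.1 hy.1).2
      (SmoothChart.mem_overlap.1 hy.2).2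
  -- At level k the map factors: the base coordinate is first moved from e₃ to e₁, the chart of the
  -- trivialization, with fibre components unchanged; then the diagonal change of charts from e₁ to
  -- e₂ is applied.
  have hcons : ∀ k : ℕ, ContDiffOn ℝ ∞ (fun q : E × (Fin k → E) =>
      Fin.cons (α := fun _ => E) ((e₁.1 ∘ e₃.1.symm) q.1) q.2)
      ((e₃.overlap e₁ ∩ e₃.overlap e₂) ×ˢ univ) := by
    refine fun k => contDiffOn_pi.2 fun a => Fin.cases ?_ (fun a => ?_) a
    · exact (e₃.contDiffOn e₁).comp contDiff_fst.contDiffOn fun q hq => hq.1.1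
    · exact ((contDiff_apply ℝ E a).comp contDiff_snd).contDiffOn
  exact frechetCkOn_powerLim n hopen (B := fun k => E × (Fin (k + 0) → E))
    (fun _ => hV.prod isOpen_univ)
    (fun k => (contDiffOn_diagExtend (e₁.isOpen_overlap e₂) (e₁.contDiffOn e₂) k).comp (hcons k)
      fun q hq => hmem q.1 hq.1)
    (fun k => (ContinuousLinearMap.id ℝ E).prodMap (PowerLim.proj E 0 k))
    (fun _ q hq => ⟨hq, trivial⟩) fun q hq =>
    C.limChart_limChartInv (ξ := PowerLim.cons (e₁.1 (e₃.1.symm q.1)) q.2) (hmem q.1 hq)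

variable [IsManifold 𝓘(ℝ, E) ∞ M]

/-- The identification of the fibre of `T^∞ M` over `x` with `lim E^i`, by the chart of `M`
at `x`. -/
noncomputable def LinearConnection.limFibreEquiv (x : M) :
    {p : InfTangent E M // p.base = x} ≃ PowerLim E 0 where
  toFun p := (C.limTrivialization (smoothChartAt E x) p.1).2
  invFun ξ := ⟨(C.limTrivialization (smoothChartAt E x)).toOpenPartialHomeomorph.symm (x, ξ),
    (C.limTrivialization (smoothChartAt E x)).proj_symm_apply' (mem_smoothChartAt_source x)⟩
  left_inv p := by
    obtain ⟨p, rfl⟩ := p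
    exact Subtype.ext ((C.limTrivialization (smoothChartAt E p.base)).symm_apply_mk_proj
      (mem_smoothChartAt_source p.base))
  right_inv ξ := congrArg Prod.snd
    ((C.limTrivialization (smoothChartAt E x)).apply_symm_apply' (mem_smoothChartAt_source x))

/-- `T^∞ M` as a generalized Fréchet vector bundle over `M`. -/
noncomputable def LinearConnection.limBundle :
    GeneralizedFrechetBundle E (SmoothChart E M) C.limAtlas
      (fun p : InfTangent E M => p.base) where
  triv := C.limTrivialization
  cover x := ⟨smoothChartAt E x, mem_smoothChartAt_source x⟩
  smooth_triv e₁ e₂ e₃ := C.frechetSmoothOn_limTrivialization e₁ e₂ e₃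
  smooth_triv_symm e₁ e₂ e₃ := C.frechetSmoothOn_limTrivialization_symm e₁ e₂ e₃
  fibreAdd x := (C.limFibreEquiv x).addCommGroup
  fibreModule x :=
    letI := (C.limFibreEquiv x).addCommGroup
    (C.limFibreEquiv x).module ℝ
  linear e x hx := by
    let _ := (C.limFibreEquiv x).addCommGroup
    let _ := (C.limFibreEquiv x).module ℝ
    have h : (fun p : {p : InfTangent E M // p.base = x} => (C.limTrivialization e p.1).2) =
        (autLimAct (autDiag ((smoothChartAt E x).coordChange e x))).comp
          ((C.limFibreEquiv x).linearEquiv ℝ).toLinearMap := by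
      funext p
      obtain ⟨p, rfl⟩ := p
      exact C.tail_limChart (mem_smoothChartAt_source p.base) hx
    rw [h]
    exact LinearMap.isLinear _
  transition e e' x := autDiag (e.coordChange e' x)
  transition_smooth e e' e'' n := by
    have hset : {y | y ∈ e''.1.target ∧ e''.1.symm y ∈ (C.limTrivialization e).baseSet ∧
        e''.1.symm y ∈ (C.limTrivialization e').baseSet} = e''.overlap e ∩ e''.overlap e' := by
      ext y
      simp only [mem_inter_iff, SmoothChart.mem_overlap]
      exact ⟨fun h => ⟨⟨h.1, h.2.1⟩, h.1, h.2.2⟩, fun h => ⟨h.1.1, h.1.2, h.2.2⟩⟩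
    rw [hset]
    have hopen := (e''.isOpen_overlap e).inter (e''.isOpen_overlap e')
    refine frechetCkOn_of_components n isClosed_endLim hopen fun k => ?_
    -- The derivative of the change of charts is smooth in operator norm, and `diagCLM` is
    -- continuous and linear in the operator; so each finite tuple of diagonal actions is smooth as
    -- well.
    have hd : ContDiffOn ℝ ∞ (fun y => fderiv ℝ (e'.1 ∘ e.1.symm) ((e.1 ∘ e''.1.symm) y))
        (e''.overlap e ∩ e''.overlap e') :=
      ((e.contDiffOn e').fderiv_of_isOpen (m := ∞) (e.isOpen_overlap e') (by simp)).comp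
        ((e''.contDiffOn e).mono inter_subset_left) fun y hy =>
          SmoothChart.apply_mem_overlap (SmoothChart.mem_overlap.1 hy.1).2
            (SmoothChart.mem_overlap.1 hy.2).2
    have hg : ContDiffOn ℝ ∞ (fun y => fun j : Fin (k + 1) =>
        diagCLM E j (fderiv ℝ (e'.1 ∘ e.1.symm) ((e.1 ∘ e''.1.symm) y)))
        (e''.overlap e ∩ e''.overlap e') :=
      contDiffOn_pi.2 fun j => (diagCLM E j).contDiff.comp_contDiffOn hd
    refine frechetCkOn_of_contDiffOn n hopen hg (ContinuousLinearMap.id ℝ E) hopen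
      (fun y hy => hy) fun y hy => funext fun j => ?_
    change (diagCLE j (e.coordChange e' (e''.1.symm y)) :
      (Fin (j : ℕ) → E) →L[ℝ] (Fin (j : ℕ) → E)) = _
    rw [coe_diagCLE, SmoothChart.coe_coordChange (SmoothChart.mem_overlap.1 hy.1).2
      (SmoothChart.mem_overlap.1 hy.2).2]
    rfl
  transition_spec e e' p hp hp' := C.tail_limChart hp hp'
  cocycle e e' e'' x hx hx' hx'' := by
    rw [← SmoothChart.coordChange_trans hx hx' hx'']
    rfl

end FrechetBundle

/-! ### The main theorem. -/

theorem mainTheorem7 {E : Type u} [NormedAddCommGroup E] [NormedSpace ℝ E] [CompleteSpace E]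
    {M : Type v} [TopologicalSpace M] [ChartedSpace E M] [IsManifold 𝓘(ℝ, E) ∞ M]
    (C : LinearConnection E M) :
    -- the model space, the fibre type and the space containing the structure group are Fréchet
    IsFrechetSpace (PowerLim E 1) ∧ IsFrechetSpace (PowerLim E 0) ∧ IsFrechetSpace (EndLim E) ∧
    -- `T^∞ M` is the projective limit of the `T^k M`
    (∃ Θ : InfTangent E M ≃ₜ TangentLim E M, 
      ∀ (p : InfTangent E M) (k : ℕ), (Θ p).1 k = p.toOrder k) ∧
    (T2Space M → T2Space (InfTangent E M)) ∧
    ∃ (_ : ∀ k : ℕ, ChartedSpace (Fin (k + 1) → E) (HigherTangent E M k))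
      (𝓑 : ∀ k : ℕ, BanachBundle E (SmoothChart E M) (Fin k → E) (Fin (k + 1) → E)
        (fun p : HigherTangent E M k => p.base))
      (𝒜 : FrechetAtlas (SmoothChart E M) (PowerLim E 1) (InfTangent E M))
      (𝓕 : GeneralizedFrechetBundle E (SmoothChart E M) 𝒜 (fun p : InfTangent E M => p.base)),
      -- the `T^k M` are Banach manifolds, with the `Ψ_e^k` and the `Φ_e^k` as smooth charts,
      -- and form a projective system of Banach manifolds
      (∀ k : ℕ, IsManifold 𝓘(ℝ, Fin (k + 1) → E) ∞ (HigherTangent E M k)) ∧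
      (∀ (k : ℕ) (e : SmoothChart E M),
        ∃ c ∈ IsManifold.maximalAtlas 𝓘(ℝ, Fin (k + 1) → E) ∞ (HigherTangent E M k),
          c.source = {p | p.base ∈ e.1.source} ∧ c.target = {ξ | ξ 0 ∈ e.1.target} ∧
          EqOn c (jetChart e k) c.source) ∧
      (∀ (k : ℕ) (e : SmoothChart E M),
        ∃ c ∈ IsManifold.maximalAtlas 𝓘(ℝ, Fin (k + 1) → E) ∞ (HigherTangent E M k),
          c.source = {p | p.base ∈ e.1.source} ∧ c.target = {ξ | ξ 0 ∈ e.1.target} ∧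
          EqOn c (C.chart e k) c.source) ∧
      (∀ (i j : ℕ) (h : i ≤ j), ContMDiff 𝓘(ℝ, Fin (j + 1) → E) 𝓘(ℝ, Fin (i + 1) → E) ∞
        (HigherTangent.restrict h : HigherTangent E M j → HigherTangent E M i)) ∧
      -- they form a strong projective system of Banach vector bundles, with the trivializations
      -- `(e⁻¹ × id) ∘ Φ_e^k`
      (∀ (k : ℕ) (e : SmoothChart E M), ((𝓑 k).triv e).baseSet = e.1.source ∧
        ∀ p : HigherTangent E M k, p.base ∈ e.1.source →
          ((𝓑 k).triv e p).2 = fun a => C.chart e k p a.succ) ∧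
      (∀ (i j : ℕ) (h : i ≤ j) (e : SmoothChart E M) (p : HigherTangent E M j),
        p.base ∈ e.1.source →
          ((𝓑 i).triv e (p.restrict h)).2 = truncate E h ((𝓑 j).triv e p).2) ∧
      -- the charts of the Fréchet manifold `T^∞ M` are the limits of the `Φ_e^k`
      (∀ e : SmoothChart E M, (𝒜.chart e).source = {p | p.base ∈ e.1.source} ∧
        (𝒜.chart e).target = {ξ | ξ.1 0 0 ∈ e.1.target} ∧
        ∀ p : InfTangent E M, p.base ∈ e.1.source →
          ∀ k : ℕ, (𝒜.chart e p).1 k = C.chart e k (p.toOrder k)) ∧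
      -- the trivializations of `π_∞` are the limits of those of the `π_k`
      (∀ e : SmoothChart E M, (𝓕.triv e).baseSet = e.1.source ∧
        ∀ p : InfTangent E M, p.base ∈ e.1.source →
          ∀ k : ℕ, (𝓕.triv e p).2.1 k = ((𝓑 k).triv e (p.toOrder k)).2) := by
  -- The limit charts and limit trivializations are built componentwise from those of finite order,
  -- so the statements identifying them as limits hold by `rfl`.
  refine ⟨isFrechetSpace_of_isClosed (isClosed_powerLim 1),
    isFrechetSpace_of_isClosed (isClosed_powerLim 0), isFrechetSpace_of_isClosed isClosed_endLim,
    ⟨InfTangent.homeoLim C, fun _ _ => rfl⟩, fun _ => C.t2Space, C.chartedSpace, C.bundle,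
    C.limAtlas, C.limBundle, C.isManifold, ?_, ?_, fun i j h => C.contMDiff_restrict h,
    fun k e => ⟨rfl, fun p _ => rfl⟩, fun i j h e p _ => ?_,
    fun e => ⟨rfl, rfl, fun p _ k => rfl⟩, fun e => ⟨rfl, fun p _ k => rfl⟩⟩
  · exact fun k e => ⟨C.jetHomeo e k, C.jetHomeo_mem e k, rfl, rfl, fun _ _ => rfl⟩
  · exact fun k e => ⟨C.chartHomeo e k, C.chartHomeo_mem e k, rfl, rfl, fun _ _ => rfl⟩
  · exact funext fun a => congrFun (C.chart_restrict e h p) a.succ
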